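/- Let $\beta>0$, $d,\eta>0$ and $\xi\in\mathbb R$ with $\sqrt{\xi^2+\eta^2}\le d$; put ${\bf e}_1=(d,0)$, ${\bf e}_2=(\xi,\eta)$, ${\bf l}_{mn}=m{\bf e}_1+n{\bf e}_2$ and let $\mathcal C=\{x_1{\bf e}_1+x_2{\bf e}_2 : x_1,x_2\in[-\frac12,\frac12]\}$ be the unit cell. Let $$G_{\rm MB}({\bf t})=-\frac{1}{2\pi\beta^2}\bigl[K_0(\beta|{\bf t}|)-\log(1/|{\bf t}|)\bigr],\qquad {\bf G}({\bf t})=\begin{pmatrix}-\partial_{yy}&\partial_{xy}\\ \partial_{xy}&-\partial_{xx}\end{pmatrix}G_{\rm MB}({\bf t})$$ be the modified biharmonic Green's function and the modified Stokeslet (here ${\bf t}=(x,y)\ne 0$ and $K_0$ is the modified Bessel function of the second kind). For ${\bf t},{\bf s}\in\mathcal C$ let $${\bf K}^{south}({\bf t},{\bf s})=\sum_{n\le -2}\ \sum_{m\in\mathbb Z}{\bf G}({\bf t}-({\bf s}+{\bf l}_{mn})),\qquad {\bf K}^{north}({\bf t},{\bf s})=\sum_{n\ge 2}\ \sum_{m\in\mathbb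 Z}{\bf G}({\bf t}-({\bf s}+{\bf l}_{mn})),$$ where the sum over $m$ is taken first for each $n$. For targets ${\bf t}_l=(x_l,y_l)\in\mathcal C$ $(1\le l\le N_T)$ and sources ${\bf s}_j=(x'_j,y'_j)\in\mathcal C$ $(1\le j\le N_S)$ let ${\bf P}^{south}$, ${\bf P}^{north}$ be the $N_T\times N_S$ matrices of $2\times2$ blocks ${\bf P}^{south}(l,j)={\bf K}^{south}({\bf t}_l,{\bf s}_j)$, ${\bf P}^{north}(l,j)={\bf K}^{north}({\bf t}_l,{\bf s}_j)$. Given a precision $0<\epsilon\le1$, let $$M=\left\lceil\frac{d}{2\pi\eta}\log\left(\frac{1}{1-e^{-2\pi\eta/d}}\,\frac1\epsilon\right)\right\rceil,$$ and for $m=-M,\dots,M$ let $\alpha_m=2\pi m/d$, $\chi_m=\sqrt{\alpha_m^2+\beta^2}$, $Q_m^{(\beta)}=\chi_m\eta-i\alpha_m\xi$, $Q_m=|\alpha_m|\eta-i\alpha_m\xi$. Define matrices of $2\times2$ blocks, with modes indexed by $-M\le m\le M$ and ${\bf D}$'s block diagonal, by $$\begin{aligned} {\bf L}_\beta^{south}(l,m)&=e^{-\chi_m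 y_l}e^{i\alpha_m x_l}{\bf I}_2, & {\bf L}_\beta^{north}(l,m)&=e^{\chi_m y_l}e^{i\alpha_m x_l}{\bf I}_2,\\ {\bf L}^{south}(l,m)&=e^{-|\alpha_m| y_l}e^{i\alpha_m x_l}{\bf I}_2, & {\bf L}^{north}(l,m)&=e^{|\alpha_m| y_l}e^{i\alpha_m x_l}{\bf I}_2,\\ {\bf R}_\beta^{south}(m,j)&=e^{\chi_m y'_j}e^{-i\alpha_m x'_j}{\bf I}_2, & {\bf R}_\beta^{north}(m,j)&=e^{-\chi_m y'_j}e^{-i\alpha_m x'_j}{\bf I}_2,\\ {\bf R}^{south}(m,j)&=e^{|\alpha_m| y'_j}e^{-i\alpha_m x'_j}{\bf I}_2, & {\bf R}^{north}(m,j)&=e^{-|\alpha_m| y'_j}e^{-i\alpha_m x'_j}{\bf I}_2, \end{aligned}$$ $$\begin{aligned} {\bf D}_\beta^{south}(m,m)&=\frac{1}{2\beta^2d}\,\frac{e^{-2Q_m^{(\beta)}}}{1-e^{-Q_m^{(\beta)}}}\begin{pmatrix}\chi_m&i\alpha_m\\ i\alpha_m&-\alpha_m^2/\chi_m\end{pmatrix},&{\bf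 D}_\beta^{north}&=\overline{{\bf D}_\beta^{south}},\\ {\bf D}^{south}(m,m)&=\frac{1}{2\beta^2d}\,\frac{e^{-2Q_m}}{1-e^{-Q_m}}\begin{pmatrix}-|\alpha_m|&-i\alpha_m\\ -i\alpha_m&|\alpha_m|\end{pmatrix}\ (m\ne0),\quad {\bf D}^{south}(0,0)=0,&{\bf D}^{north}&=\overline{{\bf D}^{south}}. \end{aligned}$$ Then, for all ${\bf t}_l$ and ${\bf s}_j$, the series over $m$ converge absolutely for each $n$ with $|n|\ge2$, the series over $n\le-2$ and over $n\ge2$ of their sums converge absolutely, and $$\begin{aligned} {\bf P}^{south}&={\bf L}_\beta^{south}{\bf D}_\beta^{south}{\bf R}_\beta^{south}+{\bf L}^{south}{\bf D}^{south}{\bf R}^{south}+O(\epsilon),\\ {\bf P}^{north}&={\bf L}_\beta^{north}{\bf D}_\beta^{north}{\bf R}_\beta^{north}+{\bf L}^{north}{\bf D}^{north}{\bf R}^{north}+O(\epsilon), \end{aligned}$$ where $O(\epsilon)$ denotes a matrix all of whose scalar entries have absolute value at most $C\epsilon$, with an absolute constant $C$ (independent of $\beta,d,\xi,\eta,\epsilon$,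 of $N_T,N_S$ and of the points). -/

import Mathlib

namespace ModifiedStokes

noncomputable section

/-- The modified Bessel function of the second kind of order zero, for `z > 0`:
`K₀(z) = ∫₀^∞ exp (-z cosh t) dt`. -/
def besselK0 (z : ℝ) : ℝ :=
  ∫ t in Set.Ioi (0 : ℝ), Real.exp (-z * Real.cosh t)

/-- The partial derivative in the first variable. -/
def partialX (f : ℝ → ℝ → ℝ) : ℝ → ℝ → ℝ :=
  fun x y => deriv (fun s => f s y) x

/-- The partial derivative in the second variable. -/
def partialY (f : ℝ → ℝ → ℝ) : ℝ → ℝ → ℝ :=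
  fun x y => deriv (fun s => f x s) y

/-- The Green's function of the modified biharmonic equation,
`G_MB(x, y) = -(K₀(β r) - log (1 / r)) / (2 π β²)` with `r = √(x² + y²)`. -/
def modifiedBiharmonicGreen (β x y : ℝ) : ℝ :=
  -(1 / (2 * Real.pi * β ^ 2)) *
    (besselK0 (β * Real.sqrt (x ^ 2 + y ^ 2)) - Real.log (1 / Real.sqrt (x ^ 2 + y ^ 2)))

/-- The modified Stokeslet `(∇ ⊗ ∇ - Δ I) G_MB`. -/
def modifiedStokeslet (β : ℝ) (p : ℝ × ℝ) : Matrix (Fin 2) (Fin 2) ℝ :=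
  !![-(partialY (partialY (modifiedBiharmonicGreen β)) p.1 p.2),
      partialX (partialY (modifiedBiharmonicGreen β)) p.1 p.2;
      partialX (partialY (modifiedBiharmonicGreen β)) p.1 p.2,
      -(partialX (partialX (modifiedBiharmonicGreen β)) p.1 p.2)]

/-- The closed unit cell spanned by `e₁ = (d, 0)` and `e₂ = (ξ, η)`, centered at the origin. -/
def unitCell (d ξ η : ℝ) : Set (ℝ × ℝ) :=
  {p | ∃ a ∈ Set.Icc (-(1 / 2) : ℝ) (1 / 2), ∃ b ∈ Set.Icc (-(1 / 2) : ℝ) (1 / 2),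
    p = a • ((d, 0) : ℝ × ℝ) + b • ((ξ, η) : ℝ × ℝ)}

/-- The lattice vector `m e₁ + n e₂`. -/
def latticeVector (d ξ η : ℝ) (m n : ℤ) : ℝ × ℝ :=
  (m : ℝ) • ((d, 0) : ℝ × ℝ) + (n : ℝ) • ((ξ, η) : ℝ × ℝ)

/-- The contribution at `t` of the image in cell `(m, n)` of a source at `s`. -/
def imageTerm (β d ξ η : ℝ) (t s : ℝ × ℝ) (m n : ℤ) : Matrix (Fin 2) (Fin 2) ℝ :=
  modifiedStokeslet β (t - (s + latticeVector d ξ η m n))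

/-- The kernel of the images in the rows `n ≤ -2`: each row is summed over `m` first, and then
the rows are summed. -/
def kernelSouth (β d ξ η : ℝ) (t s : ℝ × ℝ) : Matrix (Fin 2) (Fin 2) ℝ :=
  ∑' n : Set.Iic (-2 : ℤ), ∑' m : ℤ, imageTerm β d ξ η t s m n

/-- The kernel of the images in the rows `n ≥ 2`: each row is summed over `m` first, and then
the rows are summed. -/
def kernelNorth (β d ξ η : ℝ) (t s : ℝ × ℝ) : Matrix (Fin 2) (Fin 2) ℝ :=
  ∑' n : Set.Ici (2 : ℤ), ∑' m : ℤ, imageTerm β d ξ η t s m n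

/-- For the rows `n` in `I`, every row series over `m` converges, and so does the series of
the row sums. -/
def RowsConverge (I : Set ℤ) (β d ξ η : ℝ) (t s : ℝ × ℝ) : Prop :=
  (∀ n ∈ I, Summable fun m : ℤ => imageTerm β d ξ η t s m n) ∧
    Summable fun n : I => ∑' m : ℤ, imageTerm β d ξ η t s m n

/-- Complex matrices of `2 × 2` blocks. -/
abbrev BlockMatrix (ι κ : Type) : Type :=
  Matrix ι κ (Matrix (Fin 2) (Fin 2) ℂ)

/-- The periodizing block matrix of the south images. -/
def periodizingSouth (β d ξ η : ℝ) {NT NS : ℕ} (T : Fin NT → ℝ × ℝ) (S : Fin NS → ℝ × ℝ) :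
    BlockMatrix (Fin NT) (Fin NS) :=
  Matrix.of fun l j => (kernelSouth β d ξ η (T l) (S j)).map (fun a : ℝ => (a : ℂ))

/-- The periodizing block matrix of the north images. -/
def periodizingNorth (β d ξ η : ℝ) {NT NS : ℕ} (T : Fin NT → ℝ × ℝ) (S : Fin NS → ℝ × ℝ) :
    BlockMatrix (Fin NT) (Fin NS) :=
  Matrix.of fun l j => (kernelNorth β d ξ η (T l) (S j)).map (fun a : ℝ => (a : ℂ))

/-- The truncation order `M`; the argument of the ceiling is positive for `0 < ε ≤ 1`. -/
def truncationOrder (d η ε : ℝ) : ℕ :=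
  ⌈d / (2 * Real.pi * η) *
    Real.log (1 / (1 - Real.exp (-(2 * Real.pi * η / d))) * (1 / ε))⌉₊

/-- The modes `m = -M, …, M`. -/
abbrev Mode (M : ℕ) : Type :=
  {m : ℤ // m ∈ Finset.Icc (-(M : ℤ)) (M : ℤ)}

/-- `α_m = 2 π m / d`. -/
def alpha (d : ℝ) (m : ℤ) : ℝ := 2 * Real.pi * m / d

/-- `χ_m = √(α_m² + β²)`. -/
def chi (β d : ℝ) (m : ℤ) : ℝ := Real.sqrt (alpha d m ^ 2 + β ^ 2)

/-- `Q_m^(β) = χ_m η - i α_m ξ`. -/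
def QBeta (β d ξ η : ℝ) (m : ℤ) : ℂ := chi β d m * η - Complex.I * alpha d m * ξ

/-- `Q_m = |α_m| η - i α_m ξ`. -/
def QZero (d ξ η : ℝ) (m : ℤ) : ℂ := (|alpha d m| : ℝ) * η - Complex.I * alpha d m * ξ

/-- The left factor with blocks `exp (σ ω_m y_l) exp (i α_m x_l) I₂`. -/
def leftFactor (σ : ℝ) (ω : ℤ → ℝ) (d : ℝ) (M : ℕ) {NT : ℕ} (T : Fin NT → ℝ × ℝ) :
    BlockMatrix (Fin NT) (Mode M) :=
  Matrix.of fun l m =>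
    (Complex.exp ((σ * ω m * (T l).2 : ℝ)) * Complex.exp (Complex.I * alpha d m * (T l).1)) •
      (1 : Matrix (Fin 2) (Fin 2) ℂ)

/-- The right factor with blocks `exp (σ ω_m y'_j) exp (-i α_m x'_j) I₂`. -/
def rightFactor (σ : ℝ) (ω : ℤ → ℝ) (d : ℝ) (M : ℕ) {NS : ℕ} (S : Fin NS → ℝ × ℝ) :
    BlockMatrix (Mode M) (Fin NS) :=
  Matrix.of fun m j =>
    (Complex.exp ((σ * ω m * (S j).2 : ℝ)) * Complex.exp (-(Complex.I * alpha d m * (S j).1))) •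
      (1 : Matrix (Fin 2) (Fin 2) ℂ)

def LBetaSouth (β d : ℝ) (M : ℕ) {NT : ℕ} (T : Fin NT → ℝ × ℝ) :
    BlockMatrix (Fin NT) (Mode M) :=
  leftFactor (-1) (chi β d) d M T

def LBetaNorth (β d : ℝ) (M : ℕ) {NT : ℕ} (T : Fin NT → ℝ × ℝ) :
    BlockMatrix (Fin NT) (Mode M) :=
  leftFactor 1 (chi β d) d M T

def LSouth (d : ℝ) (M : ℕ) {NT : ℕ} (T : Fin NT → ℝ × ℝ) : BlockMatrix (Fin NT) (Mode M) :=
  leftFactor (-1) (fun m => |alpha d m|) d M T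

def LNorth (d : ℝ) (M : ℕ) {NT : ℕ} (T : Fin NT → ℝ × ℝ) : BlockMatrix (Fin NT) (Mode M) :=
  leftFactor 1 (fun m => |alpha d m|) d M T

def RBetaSouth (β d : ℝ) (M : ℕ) {NS : ℕ} (S : Fin NS → ℝ × ℝ) :
    BlockMatrix (Mode M) (Fin NS) :=
  rightFactor 1 (chi β d) d M S

def RBetaNorth (β d : ℝ) (M : ℕ) {NS : ℕ} (S : Fin NS → ℝ × ℝ) :
    BlockMatrix (Mode M) (Fin NS) :=
  rightFactor (-1) (chi β d) d M S

def RSouth (d : ℝ) (M : ℕ) {NS : ℕ} (S : Fin NS → ℝ × ℝ) : BlockMatrix (Mode M) (Fin NS) :=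
  rightFactor 1 (fun m => |alpha d m|) d M S

def RNorth (d : ℝ) (M : ℕ) {NS : ℕ} (S : Fin NS → ℝ × ℝ) : BlockMatrix (Mode M) (Fin NS) :=
  rightFactor (-1) (fun m => |alpha d m|) d M S

/-- The diagonal block of the south factor with exponentials in `χ_m`. -/
def blockBetaSouth (β d ξ η : ℝ) (m : ℤ) : Matrix (Fin 2) (Fin 2) ℂ :=
  (1 / (2 * (β : ℂ) ^ 2 * d) *
      (Complex.exp (-2 * QBeta β d ξ η m) / (1 - Complex.exp (-QBeta β d ξ η m)))) •
    !![(chi β d m : ℂ), Complex.I * alpha d m;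
      Complex.I * alpha d m, -(alpha d m : ℂ) ^ 2 / chi β d m]

/-- The diagonal block of the south factor with exponentials in `|α_m|`. At `m = 0` the matrix
in the formula vanishes (and so does the scalar denominator); the block is zero there. -/
def blockSouth (β d ξ η : ℝ) (m : ℤ) : Matrix (Fin 2) (Fin 2) ℂ :=
  if m = 0 then 0 else
    (1 / (2 * (β : ℂ) ^ 2 * d) *
        (Complex.exp (-2 * QZero d ξ η m) / (1 - Complex.exp (-QZero d ξ η m)))) •
      !![-((|alpha d m| : ℝ) : ℂ), -(Complex.I * alpha d m);
        -(Complex.I * alpha d m), ((|alpha d m| : ℝ) : ℂ)]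

def DBetaSouth (β d ξ η : ℝ) (M : ℕ) : BlockMatrix (Mode M) (Mode M) :=
  Matrix.diagonal fun m => blockBetaSouth β d ξ η m

def DSouth (β d ξ η : ℝ) (M : ℕ) : BlockMatrix (Mode M) (Mode M) :=
  Matrix.diagonal fun m => blockSouth β d ξ η m

def DBetaNorth (β d ξ η : ℝ) (M : ℕ) : BlockMatrix (Mode M) (Mode M) :=
  Matrix.diagonal fun m => (blockBetaSouth β d ξ η m).map (starRingEnd ℂ)

def DNorth (β d ξ η : ℝ) (M : ℕ) : BlockMatrix (Mode M) (Mode M) :=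
  Matrix.diagonal fun m => (blockSouth β d ξ η m).map (starRingEnd ℂ)

end

end ModifiedStokes

open ModifiedStokes

open MeasureTheory Filter Topology Real
open scoped FourierTransform

namespace ModifiedStokes

/-! Both parts of the Green's function belong to one family of integrals, `besselIntegral κ b c`:
`K₀(βr)` is half the integral of order `κ = 0` with `b = β²`, `c = r²/4`, and the derivatives of
`-log r` are the same expressions as those of `K₀`, taken at `b = 0`. Differentiation in `c` lowers
`κ` by one, so the Stokeslet is, up to the factor `1/(2πβ²)`, the difference of one matrix
`potentialMatrix b` at `b = β²` and `b = 0` (`modifiedStokeslet_eq`).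

Along a row of images the integrand is a Gaussian in the horizontal variable. Its Fourier transform
raises `κ` by `1/2` and `b` by `α²` (`fourier_besselIntegral`), and half-integer orders are
elementary (`besselIntegral_neg_half`). Poisson summation then turns each row into a series of modes
decaying like `exp (-χ_m y)` and `exp (-|α_m| y)` (`row_sum_stokeslet`). Moving one row further
multiplies such an exponential by `exp (-Q)`, so for each mode the sum over rows is geometric and
produces the diagonal blocks (`hasSum_modeTerm`). Absolute summability over rows and modes together
permits the interchange of sums.

What remains is the tail `|m| > M`. The prefactor `1/β²` is cancelled because the two exponential
families differ by `O(β²)` (`norm_modeMatrix_sub_le`). With `q = exp (-2πη/d)`, mode `m` of the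
expansion is then at most `S q^|m|`, where `S` sums `(k + 4) q^(|m| k)` over the rows. The choice of
`M` gives `q^|m| ≤ ε (1 - q) ≤ 1 - exp (-2π)`, since `η ≤ d`; hence `S` is bounded by an absolute
constant and the geometric tail by a multiple of `ε` (`truncation_error_le`).

The north case follows from the south one: the Stokeslet is even, so target and source may be
exchanged, and the kernel is real, so complex conjugation yields the conjugate blocks. -/

/-- The integral `∫ exp (κ t - b e^t - c e^{-t}) dt` over the real line. -/
noncomputable def besselIntegral (κ b c : ℝ) : ℝ :=
  ∫ t : ℝ, exp (κ * t - b * exp t - c * exp (-t))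

/-! ### Bessel-type integrals: convergence, derivatives, recurrence, closed forms -/

theorem integrable_of_exp_bounds {f : ℝ → ℝ} (hf : Continuous f) {A B p q : ℝ} (hp : p < 0)
    (hq : 0 < q) (h1 : ∀ t, 0 < t → ‖f t‖ ≤ A * exp (p * t))
    (h2 : ∀ t, t ≤ 0 → ‖f t‖ ≤ B * exp (q * t)) : Integrable f := by
  rw [← integrableOn_univ, ← Set.Iic_union_Ioi (a := (0 : ℝ))]
  refine IntegrableOn.union ?_ ?_
  · refine Integrable.mono' ((integrableOn_exp_mul_Iic hq 0).const_mul B)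
      hf.aestronglyMeasurable.restrict ?_
    filter_upwards [ae_restrict_mem measurableSet_Iic] with t ht using h2 t ht
  · refine Integrable.mono' ((integrableOn_exp_mul_Ioi hp 0).const_mul A)
      hf.aestronglyMeasurable.restrict ?_
    filter_upwards [ae_restrict_mem measurableSet_Ioi] with t ht using h1 t ht

theorem exp_neg_le_factorial_div {x : ℝ} (hx : 0 < x) (N : ℕ) :
    exp (-x) ≤ N.factorial / x ^ N := by
  have h := Real.pow_div_factorial_le_exp x hx.le N
  have hN : (0 : ℝ) < N.factorial := by exact_mod_cast N.factorial_pos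
  rw [Real.exp_neg, inv_eq_one_div, div_le_div_iff₀ (exp_pos _) (by positivity)]
  rw [div_le_iff₀ hN] at h
  linarith

/-- The integrand decays exponentially in both directions. -/
theorem besselIntegrand_integrable {κ b c : ℝ} (hb : 0 ≤ b) (hc : 0 < c) (h : 0 < b ∨ κ < 0) :
    Integrable fun t : ℝ => exp (κ * t - b * exp t - c * exp (-t)) := by
  -- With `N > |κ|`, the bound `exp (-x) ≤ N! / x ^ N` turns `exp (κ t)` into `exp ((κ + N) t)` on
  -- the left and, if `b > 0`, into `exp ((κ - N) t)` on the right; both decay.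
  obtain ⟨N, hN⟩ := exists_nat_gt |κ|
  have hN1 := abs_lt.mp hN
  have hneg : ∀ t : ℝ, ‖exp (κ * t - b * exp t - c * exp (-t))‖ ≤
      N.factorial / c ^ N * exp ((κ + N) * t) := by
    intro t
    rw [Real.norm_of_nonneg (exp_pos _).le]
    have h1 := exp_neg_le_factorial_div (mul_pos hc (exp_pos (-t))) N
    calc exp (κ * t - b * exp t - c * exp (-t))
        ≤ exp (κ * t + -(c * exp (-t))) := by
          apply Real.exp_le_exp.mpr
          have := mul_nonneg hb (exp_pos t).le
          linarith
      _ = exp (κ * t) * exp (-(c * exp (-t))) := exp_add _ _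
      _ ≤ exp (κ * t) * (N.factorial / (c * exp (-t)) ^ N) := by gcongr
      _ = _ := by
          rw [mul_pow, ← Real.exp_nat_mul, add_mul, exp_add]
          have : exp (↑N * -t) = (exp (↑N * t))⁻¹ := by rw [← Real.exp_neg]; ring_nf
          rw [this]
          field_simp
  rcases h with hb' | hκ
  · refine integrable_of_exp_bounds (by fun_prop) (p := κ - N) (q := κ + N)
      (A := N.factorial / b ^ N) (by linarith) (by linarith) (fun t _ => ?_) (fun t _ => hneg t)
    rw [Real.norm_of_nonneg (exp_pos _).le]
    have h1 := exp_neg_le_factorial_div (mul_pos hb' (exp_pos t)) N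
    calc exp (κ * t - b * exp t - c * exp (-t))
        ≤ exp (κ * t + -(b * exp t)) := by
          apply Real.exp_le_exp.mpr
          have := mul_nonneg hc.le (exp_pos (-t)).le
          linarith
      _ = exp (κ * t) * exp (-(b * exp t)) := exp_add _ _
      _ ≤ exp (κ * t) * (N.factorial / (b * exp t) ^ N) := by gcongr
      _ = _ := by
          rw [mul_pow, ← Real.exp_nat_mul, sub_mul, exp_sub]
          field_simp
  · refine integrable_of_exp_bounds (by fun_prop) (p := κ) (q := κ + N)
      (A := 1) hκ (by linarith) (fun t _ => ?_) (fun t _ => hneg t)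
    rw [Real.norm_of_nonneg (exp_pos _).le, one_mul]
    apply Real.exp_le_exp.mpr
    have := mul_nonneg hc.le (exp_pos (-t)).le
    have := mul_nonneg hb (exp_pos t).le
    linarith

theorem besselIntegral_nonneg (κ b c : ℝ) : 0 ≤ besselIntegral κ b c :=
  integral_nonneg fun _ => (exp_pos _).le

/-- Gives bounds uniform in `b`, since the `b = 0` integrals of orders `-1` and `-2` are explicit.
-/
theorem besselIntegral_le_zero {κ b c : ℝ} (hb : 0 ≤ b) (hc : 0 < c) (h : κ < 0) :
    besselIntegral κ b c ≤ besselIntegral κ 0 c := by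
  refine integral_mono (besselIntegrand_integrable hb hc (.inr h))
    (besselIntegrand_integrable le_rfl hc (.inr h)) fun t => ?_
  apply Real.exp_le_exp.mpr
  have := mul_nonneg hb (exp_pos t).le
  linarith

/-- Differentiation under the integral brings down `-exp (-t)`, which lowers the order. For
parameters above `c / 2` the integrand with `c / 2` dominates. -/
theorem hasDerivAt_besselIntegral {κ b c : ℝ} (hb : 0 ≤ b) (hc : 0 < c) (h : 0 < b ∨ κ < 0) :
    HasDerivAt (fun c => besselIntegral κ b c) (-besselIntegral (κ - 1) b c) c := by
  have h' : 0 < b ∨ κ - 1 < 0 := h.imp_right fun h => by linarith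
  have key := (hasDerivAt_integral_of_dominated_loc_of_deriv_le (μ := volume)
    (F := fun c t => exp (κ * t - b * exp t - c * exp (-t)))
    (F' := fun c t => -(exp ((κ - 1) * t - b * exp t - c * exp (-t))))
    (bound := fun t => exp ((κ - 1) * t - b * exp t - c / 2 * exp (-t)))
    (x₀ := c) (s := Set.Ioi (c / 2)) (Ioi_mem_nhds (by linarith))
    (.of_forall fun c => Continuous.aestronglyMeasurable (by fun_prop))
    (besselIntegrand_integrable hb hc h)
    (Continuous.aestronglyMeasurable (by fun_prop)) (.of_forall fun t x hx => ?_)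
    (besselIntegrand_integrable hb (half_pos hc) h') (.of_forall fun t x _ => ?_)).2
  · exact key.congr_deriv (by rw [integral_neg, besselIntegral])
  · rw [norm_neg, Real.norm_of_nonneg (exp_pos _).le]
    apply Real.exp_le_exp.mpr
    have := mul_le_mul_of_nonneg_right (le_of_lt hx) (exp_pos (-t)).le
    linarith
  · have h1 : HasDerivAt (fun x : ℝ => κ * t - b * exp t - x * exp (-t)) (-(1 * exp (-t))) x :=
      ((hasDerivAt_id x).mul_const _).const_sub _
    refine h1.exp.congr_deriv ?_
    rw [sub_mul, one_mul, mul_neg, ← exp_add, one_mul]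
    ring_nf

/-- Integration by parts. -/
theorem besselIntegral_recurrence {κ b c : ℝ} (hb : 0 ≤ b) (hc : 0 < c) (h : 0 < b ∨ κ < 0) :
    κ * besselIntegral κ b c - b * besselIntegral (κ + 1) b c + c * besselIntegral (κ - 1) b c
      = 0 := by
  have i0 := besselIntegrand_integrable hb hc h
  have i1 := besselIntegrand_integrable (κ := κ - 1) hb hc (h.imp_right fun h => by linarith)
  have i2 : Integrable fun t : ℝ => b * exp ((κ + 1) * t - b * exp t - c * exp (-t)) := by
    rcases hb.eq_or_lt with rfl | hb'
    · simp
    · exact (besselIntegrand_integrable hb hc (.inl hb')).const_mul b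
  have hd : ∀ t : ℝ, HasDerivAt (fun t => exp (κ * t - b * exp t - c * exp (-t)))
      (κ * exp (κ * t - b * exp t - c * exp (-t)) -
        b * exp ((κ + 1) * t - b * exp t - c * exp (-t)) +
        c * exp ((κ - 1) * t - b * exp t - c * exp (-t))) t := by
    intro t
    have h1 : HasDerivAt (fun t : ℝ => κ * t - b * exp t - c * exp (-t))
        (κ * 1 - b * exp t - c * (exp (-t) * -1)) t :=
      (((hasDerivAt_id t).const_mul κ).sub ((Real.hasDerivAt_exp t).const_mul b)).sub
        ((hasDerivAt_neg t).exp.const_mul c)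
    refine h1.exp.congr_deriv ?_
    have e1 : exp ((κ + 1) * t - b * exp t - c * exp (-t)) =
      exp (κ * t - b * exp t - c * exp (-t)) * exp t := by rw [← exp_add]; ring_nf
    have e2 : exp ((κ - 1) * t - b * exp t - c * exp (-t)) =
      exp (κ * t - b * exp t - c * exp (-t)) * exp (-t) := by rw [← exp_add]; ring_nf
    rw [e1, e2]
    ring
  have := integral_eq_zero_of_hasDerivAt_of_integrable hd
    (((i0.const_mul κ).sub i2).add (i1.const_mul c)) i0
  have h1 := integral_add ((i0.const_mul κ).sub i2) (i1.const_mul c)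
  have h2 := integral_sub (i0.const_mul κ) i2
  simp only [Pi.sub_apply] at h1
  rw [h1, h2, integral_const_mul, integral_const_mul, integral_const_mul] at this
  exact this

/-- The substitution `t ↦ 2 log (q / p) - t` exchanges `p² exp t` and `q² exp (-t)`. -/
theorem besselIntegral_reflect {p q : ℝ} (hp : 0 < p) (hq : 0 < q) (κ : ℝ) :
    besselIntegral κ (p ^ 2) (q ^ 2) =
      exp (κ * (2 * log (q / p))) * besselIntegral (-κ) (p ^ 2) (q ^ 2) := by
  rw [besselIntegral, ← integral_sub_left_eq_self _ volume (2 * log (q / p)), besselIntegral,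
    ← integral_const_mul]
  congr 1
  ext t
  have e : exp (2 * log (q / p)) = q ^ 2 / p ^ 2 := by
    rw [mul_comm, exp_mul, exp_log (by positivity), Real.rpow_two, div_pow]
  rw [← exp_add]
  have e1 : p ^ 2 * exp (2 * log (q / p) - t) = q ^ 2 * exp (-t) := by
    rw [sub_eq_add_neg, exp_add, e]
    field_simp
  have e2 : q ^ 2 * exp (-(2 * log (q / p) - t)) = p ^ 2 * exp t := by
    rw [neg_sub, exp_sub, e]
    field_simp
  rw [e1, e2]
  ring_nf

theorem besselIntegral_half {p q : ℝ} (hp : 0 < p) (hq : 0 < q) :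
    p * besselIntegral (1 / 2) (p ^ 2) (q ^ 2) = q * besselIntegral (-(1 / 2)) (p ^ 2) (q ^ 2) := by
  rw [besselIntegral_reflect hp hq, show (1 / 2 : ℝ) * (2 * log (q / p)) = log (q / p) by ring,
    exp_log (by positivity)]
  field_simp

theorem besselIntegral_neg_one_zero {c : ℝ} (hc : 0 < c) : besselIntegral (-1) 0 c = 1 / c := by
  have hi := besselIntegrand_integrable (κ := -1) le_rfl hc (.inr (by norm_num))
  have hd : ∀ t : ℝ, HasDerivAt (fun t => exp (-(c * exp (-t))) / c)
      (exp (-1 * t - 0 * exp t - c * exp (-t))) t := by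
    intro t
    refine ((((hasDerivAt_neg t).exp.const_mul c).neg.exp).div_const c).congr_deriv ?_
    simp only [Pi.neg_apply]
    rw [show -1 * t - 0 * exp t - c * exp (-t) = -(c * exp (-t)) + -t by ring, exp_add]
    field_simp
  have h0 : Tendsto (fun t : ℝ => exp (-(c * exp (-t))) / c) atBot (𝓝 0) := by
    have : Tendsto (fun t : ℝ => c * exp (-t)) atBot atTop :=
      (Real.tendsto_exp_atTop.comp tendsto_neg_atBot_atTop).const_mul_atTop hc
    simpa using (Real.tendsto_exp_atBot.comp (tendsto_neg_atTop_atBot.comp this)).div_const c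
  have h1 : Tendsto (fun t : ℝ => exp (-(c * exp (-t))) / c) atTop (𝓝 (1 / c)) := by
    have : Tendsto (fun t : ℝ => c * exp (-t)) atTop (𝓝 (c * 0)) :=
      (Real.tendsto_exp_atBot.comp tendsto_neg_atTop_atBot).const_mul c
    have h2 := ((Real.continuous_exp.tendsto _).comp this.neg).div_const c
    simpa using h2
  rw [besselIntegral, integral_of_hasDerivAt_of_tendsto hd hi h0 h1, sub_zero]

theorem besselIntegral_neg_two_zero {c : ℝ} (hc : 0 < c) :
    besselIntegral (-2) 0 c = 1 / c ^ 2 := by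
  have := besselIntegral_recurrence (κ := -1) le_rfl hc (.inr (by norm_num))
  rw [besselIntegral_neg_one_zero hc] at this
  norm_num at this
  field_simp
  field_simp at this
  linarith

/-- Evenness of `cosh` doubles the half-line integral, and the shift of `t` by `log (2β / r)` turns
`β r cosh t` into `β² exp t + (r² / 4) exp (-t)`. -/
theorem besselK0_eq {β r : ℝ} (hβ : 0 < β) (hr : 0 < r) :
    besselK0 (β * r) = besselIntegral 0 (β ^ 2) (r ^ 2 / 4) / 2 := by
  have h := integral_comp_abs (f := fun t => exp (-(β * r) * cosh t))
  simp only [Real.cosh_abs] at h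
  rw [besselK0, eq_div_iff two_ne_zero, mul_comm, ← h, besselIntegral,
    ← integral_add_right_eq_self _ (log (2 * β / r))]
  congr 1
  ext t
  congr 1
  rw [Real.cosh_eq, neg_add, exp_add, exp_add, Real.exp_neg (log _), exp_log (by positivity)]
  field_simp
  ring

theorem integral_comp_mul_abs_deriv_gaussian {φ φ' : ℝ → ℝ} (hd : ∀ t, HasDerivAt φ (φ' t) t)
    (hi : Function.Injective φ) {s : Set ℝ} (hs : Set.range φ = s) :
    ∫ t, |φ' t| * exp (-φ t ^ 2) = ∫ x in s, exp (-x ^ 2) := by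
  have := integral_image_eq_integral_abs_deriv_smul MeasurableSet.univ
    (fun t _ => (hd t).hasDerivWithinAt) hi.injOn (fun x => exp (-x ^ 2))
  rw [Set.image_univ, hs, setIntegral_univ] at this
  exact this.symm

/-- For `p > 0` substitute `u = p exp (t/2) - q exp (-t/2)` in the Gaussian integral: `-u² = 2pq -
p² exp t - q² exp (-t)`, and `du` produces the orders `1/2` and `-1/2`, which `besselIntegral_half`
makes proportional. For `p = 0` the substitution `q exp (-t/2)` covers only a half-line. -/
theorem besselIntegral_neg_half {p q : ℝ} (hp : 0 ≤ p) (hq : 0 < q) :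
    besselIntegral (-(1 / 2)) (p ^ 2) (q ^ 2) = sqrt π / q * exp (-(2 * p * q)) := by
  have sqe : ∀ t : ℝ, exp (t / 2) ^ 2 = exp t := fun t => by
    rw [← Real.exp_nat_mul]; congr 1; push_cast; ring
  have mule : ∀ t : ℝ, exp (t / 2) * exp (-t / 2) = 1 := fun t => by
    rw [← exp_add, ← Real.exp_zero]; congr 1; ring
  rcases hp.eq_or_lt with rfl | hp
  · have hd : ∀ t : ℝ, HasDerivAt (fun t => q * exp (-t / 2)) (-(q / 2 * exp (-t / 2))) t := by
      intro t
      refine (((hasDerivAt_neg t).div_const 2).exp.const_mul q).congr_deriv ?_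
      ring
    have hinj : Function.Injective fun t => q * exp (-t / 2) := by
      intro x y h
      have := Real.exp_injective (mul_left_cancel₀ hq.ne' h)
      linarith
    have hr : Set.range (fun t => q * exp (-t / 2)) = Set.Ioi 0 := by
      ext x
      constructor
      · rintro ⟨t, rfl⟩
        exact mul_pos hq (exp_pos _)
      · intro hx
        have hx : 0 < x := hx
        refine ⟨-2 * log (x / q), ?_⟩
        simp only
        rw [show -(-2 * log (x / q)) / 2 = log (x / q) by ring, exp_log (by positivity)]
        field_simp
    have h := integral_comp_mul_abs_deriv_gaussian hd hinj hr
    have hg := integral_gaussian_Ioi 1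
    simp only [neg_one_mul, div_one] at hg
    rw [hg] at h
    have e : ∀ t : ℝ, |(-(q / 2 * exp (-t / 2)))| * exp (-(q * exp (-t / 2)) ^ 2) =
        q / 2 * exp (-(1 / 2) * t - 0 ^ 2 * exp t - q ^ 2 * exp (-t)) := by
      intro t
      rw [abs_neg, abs_of_pos (by positivity), mul_pow, sqe, mul_assoc, ← exp_add]
      ring_nf
    simp only [e] at h
    rw [integral_const_mul] at h
    rw [besselIntegral]
    simp only [mul_zero, zero_mul, neg_zero, Real.exp_zero, mul_one]
    rw [eq_div_iff hq.ne']
    linarith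
  · have hd : ∀ t : ℝ, HasDerivAt (fun t => p * exp (t / 2) - q * exp (-t / 2))
        (p / 2 * exp (t / 2) + q / 2 * exp (-t / 2)) t := by
      intro t
      refine ((((hasDerivAt_id t).div_const 2).exp.const_mul p).sub
        (((hasDerivAt_neg t).div_const 2).exp.const_mul q)).congr_deriv ?_
      simp only [id]
      ring
    have hmono : StrictMono fun t => p * exp (t / 2) - q * exp (-t / 2) := by
      intro x y h
      have h1 : exp (x / 2) < exp (y / 2) := Real.exp_lt_exp.mpr (by linarith)
      have h2 : exp (-y / 2) < exp (-x / 2) := Real.exp_lt_exp.mpr (by linarith)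
      have := mul_lt_mul_of_pos_left h1 hp
      have := mul_lt_mul_of_pos_left h2 hq
      simp only
      linarith
    have hr : Set.range (fun t => p * exp (t / 2) - q * exp (-t / 2)) = Set.univ := by
      refine Set.range_eq_univ.mpr (Continuous.surjective (by fun_prop) ?_ ?_)
      · refine tendsto_atTop_mono' _ (f₁ := fun t => p * exp (t / 2) - q) ?_ ?_
        · filter_upwards [eventually_ge_atTop 0] with t ht
          have : exp (-t / 2) ≤ 1 := Real.exp_le_one_iff.mpr (by linarith)
          nlinarith
        · exact tendsto_atTop_add_const_right _ _ ((Real.tendsto_exp_atTop.comp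
            (tendsto_id.atTop_div_const two_pos)).const_mul_atTop hp)
      · refine tendsto_atBot_mono' (l := atBot) (f₂ := fun t => p * exp (t / 2) - q * exp (-t / 2))
          (f₁ := fun t => p - q * exp (-t / 2)) ?_ ?_
        · filter_upwards [eventually_le_atBot 0] with t ht
          have : exp (t / 2) ≤ 1 := Real.exp_le_one_iff.mpr (by linarith)
          nlinarith
        · refine tendsto_atBot_add_const_left _ _ (tendsto_neg_atTop_atBot.comp
            ((Real.tendsto_exp_atTop.comp
            (tendsto_neg_atBot_atTop.atTop_div_const two_pos)).const_mul_atTop hq))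
    have h := integral_comp_mul_abs_deriv_gaussian hd hmono.injective hr
    have hg := integral_gaussian 1
    simp only [neg_one_mul, div_one] at hg
    rw [setIntegral_univ, hg] at h
    have e : ∀ t : ℝ, |p / 2 * exp (t / 2) + q / 2 * exp (-t / 2)| *
        exp (-(p * exp (t / 2) - q * exp (-t / 2)) ^ 2) =
        exp (2 * p * q) * (p / 2 * exp (1 / 2 * t - p ^ 2 * exp t - q ^ 2 * exp (-t))
        + q / 2 * exp (-(1 / 2) * t - p ^ 2 * exp t - q ^ 2 * exp (-t))) := by
      intro t
      rw [abs_of_pos (by positivity)]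
      have : -(p * exp (t / 2) - q * exp (-t / 2)) ^ 2 =
          2 * p * q - p ^ 2 * exp t - q ^ 2 * exp (-t) := by
        rw [← sqe t, ← sqe (-t)]
        linear_combination 2 * p * q * mule t
      rw [this, sub_sub, sub_sub, sub_sub, exp_sub, exp_sub, exp_sub,
        show 1 / 2 * t = t / 2 by ring, show -(1 / 2) * t = -t / 2 by ring]
      field_simp
    simp only [e] at h
    have i1 := besselIntegrand_integrable (κ := 1 / 2) (sq_nonneg p) (pow_pos hq 2)
      (.inl (pow_pos hp 2))
    have i2 := besselIntegrand_integrable (κ := -(1 / 2)) (sq_nonneg p) (pow_pos hq 2)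
      (.inl (pow_pos hp 2))
    rw [integral_const_mul, integral_add (i1.const_mul _) (i2.const_mul _), integral_const_mul,
      integral_const_mul] at h
    have hh := besselIntegral_half hp hq
    change _ * (p / 2 * besselIntegral _ _ _ + q / 2 * besselIntegral _ _ _) = _ at h
    rw [Real.exp_neg]
    field_simp
    linear_combination h - exp (2 * p * q) / 2 * hh


/-! ### Second derivatives of the Green's function -/

/-- The second `y`-derivative of `K₀(√b r)` for `b > 0`, and of `-log r` for `b = 0`. -/
noncomputable def potentialYY (b x y : ℝ) : ℝ :=
  -(1 / 4) * besselIntegral (-1) b ((x ^ 2 + y ^ 2) / 4) +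
    y ^ 2 / 8 * besselIntegral (-2) b ((x ^ 2 + y ^ 2) / 4)

/-- The second `x`-derivative of `K₀(√b r)` for `b > 0`, and of `-log r` for `b = 0`. -/
noncomputable def potentialXX (b x y : ℝ) : ℝ :=
  -(1 / 4) * besselIntegral (-1) b ((x ^ 2 + y ^ 2) / 4) +
    x ^ 2 / 8 * besselIntegral (-2) b ((x ^ 2 + y ^ 2) / 4)

/-- The mixed derivative of `K₀(√b r)` for `b > 0`, and of `-log r` for `b = 0`. -/
noncomputable def potentialXY (b x y : ℝ) : ℝ :=
  x * y / 8 * besselIntegral (-2) b ((x ^ 2 + y ^ 2) / 4)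

theorem hasDerivAt_besselIntegral_div_four {κ b s : ℝ} (hb : 0 ≤ b) (hs : 0 < s)
    (h : 0 < b ∨ κ < 0) :
    HasDerivAt (fun s => besselIntegral κ b (s / 4)) (-besselIntegral (κ - 1) b (s / 4) / 4) s := by
  have h1 : HasDerivAt (fun s : ℝ => s / 4) (1 / 4) s := (hasDerivAt_id s).div_const 4
  have h2 := (hasDerivAt_besselIntegral hb (by positivity : 0 < s / 4) h).comp s h1
  exact h2.congr_deriv (by ring)

/-- The modified biharmonic Green's function as a function of `r ^ 2`. -/
noncomputable def radialGreen (β s : ℝ) : ℝ :=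
  -(1 / (2 * π * β ^ 2)) * (besselIntegral 0 (β ^ 2) (s / 4) / 2 + log s / 2)

/-- The derivative of `radialGreen`. -/
noncomputable def radialGreenDeriv (β s : ℝ) : ℝ :=
  1 / (2 * π * β ^ 2) * ((besselIntegral (-1) (β ^ 2) (s / 4) - besselIntegral (-1) 0 (s / 4)) / 8)

/-- The second derivative of `radialGreen`. -/
noncomputable def radialGreenDerivTwo (β s : ℝ) : ℝ :=
  -(1 / (2 * π * β ^ 2)) *
    ((besselIntegral (-2) (β ^ 2) (s / 4) - besselIntegral (-2) 0 (s / 4)) / 32)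

theorem hasDerivAt_radialGreen {β s : ℝ} (hβ : 0 < β) (hs : 0 < s) :
    HasDerivAt (radialGreen β) (radialGreenDeriv β s) s := by
  have h := hasDerivAt_besselIntegral_div_four (κ := 0) (sq_nonneg β) hs (.inl (pow_pos hβ 2))
  refine (((h.div_const 2).add ((Real.hasDerivAt_log hs.ne').div_const 2)).const_mul
    (-(1 / (2 * π * β ^ 2)))).congr_deriv ?_
  -- The logarithm contributes `1 / (2s)`, which is the order `-1` integral at `b = 0`, equal to `4
  -- / s`, divided by `8`.
  rw [radialGreenDeriv, besselIntegral_neg_one_zero (by positivity), zero_sub]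
  field_simp
  ring

theorem hasDerivAt_radialGreenDeriv {β s : ℝ} (hβ : 0 < β) (hs : 0 < s) :
    HasDerivAt (radialGreenDeriv β) (radialGreenDerivTwo β s) s := by
  have h := hasDerivAt_besselIntegral_div_four (κ := -1) (sq_nonneg β) hs (.inl (pow_pos hβ 2))
  have h' := hasDerivAt_besselIntegral_div_four (κ := -1) le_rfl hs (.inr (by norm_num))
  refine (((h.sub h').div_const 8).const_mul (1 / (2 * π * β ^ 2))).congr_deriv ?_
  rw [radialGreenDerivTwo]
  norm_num
  ring

theorem modifiedBiharmonicGreen_eq {β x y : ℝ} (hβ : 0 < β) (h : 0 < x ^ 2 + y ^ 2) :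
    modifiedBiharmonicGreen β x y = radialGreen β (x ^ 2 + y ^ 2) := by
  rw [modifiedBiharmonicGreen, besselK0_eq hβ (Real.sqrt_pos.mpr h), Real.sq_sqrt h.le,
    radialGreen, one_div (sqrt _), Real.log_inv, Real.log_sqrt h.le, sub_neg_eq_add]

theorem hasDerivAt_sq_add_left (x y : ℝ) : HasDerivAt (fun s => s ^ 2 + y ^ 2) (2 * x) x := by
  simpa using (hasDerivAt_pow 2 x).add_const (y ^ 2)

theorem hasDerivAt_sq_add_right (x y : ℝ) : HasDerivAt (fun s => x ^ 2 + s ^ 2) (2 * y) y := by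
  simpa using (hasDerivAt_pow 2 y).const_add (x ^ 2)

theorem sq_add_sq_pos {y : ℝ} (x : ℝ) (hy : y ≠ 0) : 0 < x ^ 2 + y ^ 2 := by positivity

theorem partialY_green {β x y : ℝ} (hβ : 0 < β) (hy : y ≠ 0) :
    partialY (modifiedBiharmonicGreen β) x y = radialGreenDeriv β (x ^ 2 + y ^ 2) * (2 * y) := by
  have h := (hasDerivAt_radialGreen hβ (sq_add_sq_pos x hy)).comp y (hasDerivAt_sq_add_right x y)
  refine (h.congr_of_eventuallyEq ?_).deriv
  filter_upwards [isOpen_ne.mem_nhds hy] with s hs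
  exact modifiedBiharmonicGreen_eq hβ (sq_add_sq_pos x hs)

theorem partialX_green {β x y : ℝ} (hβ : 0 < β) (hy : y ≠ 0) :
    partialX (modifiedBiharmonicGreen β) x y = radialGreenDeriv β (x ^ 2 + y ^ 2) * (2 * x) := by
  have h := (hasDerivAt_radialGreen hβ (sq_add_sq_pos x hy)).comp x (hasDerivAt_sq_add_left x y)
  refine (h.congr_of_eventuallyEq (.of_forall fun s => ?_)).deriv
  exact modifiedBiharmonicGreen_eq hβ (sq_add_sq_pos s hy)

theorem partialY_partialY_green {β x y : ℝ} (hβ : 0 < β) (hy : y ≠ 0) :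
    partialY (partialY (modifiedBiharmonicGreen β)) x y =
      -(1 / (2 * π * β ^ 2)) * (potentialYY (β ^ 2) x y - potentialYY 0 x y) := by
  have h := ((hasDerivAt_radialGreenDeriv hβ (sq_add_sq_pos x hy)).comp y
    (hasDerivAt_sq_add_right x y)).mul ((hasDerivAt_id y).const_mul 2)
  refine (h.congr_of_eventuallyEq ?_).deriv.trans ?_
  · filter_upwards [isOpen_ne.mem_nhds hy] with s hs
    exact partialY_green hβ hs
  · simp only [radialGreenDeriv, radialGreenDerivTwo, potentialYY, Function.comp_apply, id]
    ring

theorem partialX_partialX_green {β x y : ℝ} (hβ : 0 < β) (hy : y ≠ 0) :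
    partialX (partialX (modifiedBiharmonicGreen β)) x y =
      -(1 / (2 * π * β ^ 2)) * (potentialXX (β ^ 2) x y - potentialXX 0 x y) := by
  have h := ((hasDerivAt_radialGreenDeriv hβ (sq_add_sq_pos x hy)).comp x
    (hasDerivAt_sq_add_left x y)).mul ((hasDerivAt_id x).const_mul 2)
  refine (h.congr_of_eventuallyEq (.of_forall fun s => ?_)).deriv.trans ?_
  · exact partialX_green hβ hy
  · simp only [radialGreenDeriv, radialGreenDerivTwo, potentialXX, Function.comp_apply, id]
    ring

theorem partialX_partialY_green {β x y : ℝ} (hβ : 0 < β) (hy : y ≠ 0) :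
    partialX (partialY (modifiedBiharmonicGreen β)) x y =
      -(1 / (2 * π * β ^ 2)) * (potentialXY (β ^ 2) x y - potentialXY 0 x y) := by
  have h := ((hasDerivAt_radialGreenDeriv hβ (sq_add_sq_pos x hy)).comp x
    (hasDerivAt_sq_add_left x y)).mul_const (2 * y)
  refine (h.congr_of_eventuallyEq (.of_forall fun s => ?_)).deriv.trans ?_
  · exact partialY_green hβ hy
  · simp only [radialGreenDerivTwo, potentialXY]
    ring

/-- The entries of `∇ ⊗ ∇ - Δ I` applied to `K₀(√b r)`, resp. `-log r`, times `-1`. -/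
noncomputable def potentialMatrix (b : ℝ) (p : ℝ × ℝ) : Matrix (Fin 2) (Fin 2) ℝ :=
  !![potentialYY b p.1 p.2, -potentialXY b p.1 p.2; -potentialXY b p.1 p.2, potentialXX b p.1 p.2]

/-- Reduces the Bessel and logarithmic parts to one matrix function at two values of `b`, so that a
single Fourier computation serves both. -/
theorem modifiedStokeslet_eq {β : ℝ} {p : ℝ × ℝ} (hβ : 0 < β) (hp : p.2 ≠ 0) :
    modifiedStokeslet β p =
      (1 / (2 * π * β ^ 2)) • (potentialMatrix (β ^ 2) p - potentialMatrix 0 p) := by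
  rw [modifiedStokeslet, partialY_partialY_green hβ hp, partialX_partialX_green hβ hp,
    partialX_partialY_green hβ hp]
  ext i j
  fin_cases i <;> fin_cases j <;> simp [potentialMatrix] <;> ring

theorem potentialMatrix_neg (b : ℝ) (p : ℝ × ℝ) : potentialMatrix b (-p) = potentialMatrix b p := by
  simp [potentialMatrix, potentialYY, potentialXX, potentialXY]

theorem modifiedStokeslet_neg {β : ℝ} {p : ℝ × ℝ} (hβ : 0 < β) (hp : p.2 ≠ 0) :
    modifiedStokeslet β (-p) = modifiedStokeslet β p := by
  rw [modifiedStokeslet_eq hβ hp, modifiedStokeslet_eq hβ (by simpa using hp),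
    potentialMatrix_neg, potentialMatrix_neg]


/-! ### Fourier transform of the integrals along a row -/

theorem besselIntegrand_scaled (κ b d y u t : ℝ) :
    exp (κ * t - b * exp t - ((d * u) ^ 2 + y ^ 2) / 4 * exp (-t)) =
      exp (κ * t - b * exp t - y ^ 2 / 4 * exp (-t)) * exp (-(d ^ 2 / 4 * exp (-t)) * u ^ 2) := by
  rw [← exp_add]
  ring_nf

theorem sqrt_pi_div_exp {d : ℝ} (hd : 0 < d) (t : ℝ) :
    sqrt (π / (d ^ 2 / 4 * exp (-t))) = 2 * sqrt π / d * exp (1 / 2 * t) := by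
  have : π / (d ^ 2 / 4 * exp (-t)) = π * (2 / d * exp (1 / 2 * t)) ^ 2 := by
    rw [mul_pow, ← Real.exp_nat_mul, Real.exp_neg]
    field_simp
    norm_num
  rw [this, Real.sqrt_mul pi_nonneg, Real.sqrt_sq (by positivity)]
  ring

/-- Integrating the Gaussian in `u` yields a factor `exp (t / 2)`, so the order that must converge
is `κ + 1/2`. -/
theorem integrable_gaussian_prod {κ b d y : ℝ} (hb : 0 ≤ b) (hd : 0 < d) (hy : 0 < y)
    (h : 0 < b ∨ κ + 1 / 2 < 0) :
    Integrable (Function.uncurry fun u t : ℝ =>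
      exp (κ * t - b * exp t - ((d * u) ^ 2 + y ^ 2) / 4 * exp (-t))) (volume.prod volume) := by
  rw [integrable_prod_iff' (Continuous.aestronglyMeasurable (by fun_prop))]
  simp only [Function.uncurry_apply_pair, besselIntegrand_scaled]
  refine ⟨.of_forall fun t => (integrable_exp_neg_mul_sq (by positivity)).const_mul _, ?_⟩
  have : ∀ t : ℝ, ∫ u : ℝ, ‖exp (κ * t - b * exp t - y ^ 2 / 4 * exp (-t)) *
      exp (-(d ^ 2 / 4 * exp (-t)) * u ^ 2)‖ =
      2 * sqrt π / d * exp ((κ + 1 / 2) * t - b * exp t - y ^ 2 / 4 * exp (-t)) := by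
    intro t
    simp only [norm_mul, Real.norm_of_nonneg (exp_pos _).le]
    rw [integral_const_mul, integral_gaussian, sqrt_pi_div_exp hd, mul_left_comm, ← exp_add]
    ring_nf
  simp only [this]
  exact (besselIntegrand_integrable hb (by positivity) h).const_mul _

theorem integrable_besselIntegral {κ b d y : ℝ} (hb : 0 ≤ b) (hd : 0 < d) (hy : 0 < y)
    (h : 0 < b ∨ κ + 1 / 2 < 0) :
    Integrable fun u : ℝ => besselIntegral κ b (((d * u) ^ 2 + y ^ 2) / 4) :=
  (integrable_gaussian_prod hb hd hy h).integral_prod_left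

theorem fourier_gaussian_scaled {d : ℝ} (hd : 0 < d) (w t : ℝ) :
    ∫ u : ℝ, Complex.exp (↑(-2 * π * u * w) * Complex.I) *
      ((exp (-(d ^ 2 / 4 * exp (-t)) * u ^ 2) : ℝ) : ℂ) =
      ((2 * sqrt π / d * exp (1 / 2 * t) * exp (-((2 * π * w / d) ^ 2 * exp t)) : ℝ) : ℂ) := by
  have hb : 0 < d ^ 2 / 4 * exp (-t) := by positivity
  have h := fourierIntegral_gaussian (b := ((d ^ 2 / 4 * exp (-t) : ℝ) : ℂ))
    (by rwa [Complex.ofReal_re]) ((-2 * π * w : ℝ) : ℂ)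
  have e : ∀ u : ℝ, Complex.exp (↑(-2 * π * u * w) * Complex.I) *
      ((exp (-(d ^ 2 / 4 * exp (-t)) * u ^ 2) : ℝ) : ℂ) =
      Complex.exp (Complex.I * ((-2 * π * w : ℝ) : ℂ) * u) *
        Complex.exp (-((d ^ 2 / 4 * exp (-t) : ℝ) : ℂ) * u ^ 2) := by
    intro u
    push_cast
    ring_nf
  simp only [e]
  rw [h, ← sqrt_pi_div_exp hd, Real.sqrt_eq_rpow]
  have hp : (π : ℂ) / ((d ^ 2 / 4 * exp (-t) : ℝ) : ℂ) =
      ((π / (d ^ 2 / 4 * exp (-t)) : ℝ) : ℂ) := by push_cast; rfl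
  rw [hp, show (1 / 2 : ℂ) = ((1 / 2 : ℝ) : ℂ) by push_cast; rfl,
    ← Complex.ofReal_cpow (by positivity)]
  have hq : -((-2 * π * w : ℝ) : ℂ) ^ 2 / (4 * ((d ^ 2 / 4 * exp (-t) : ℝ) : ℂ)) =
      ((-((2 * π * w / d) ^ 2 * exp t) : ℝ) : ℂ) := by
    have : -((-2 * π * w : ℝ)) ^ 2 / (4 * (d ^ 2 / 4 * exp (-t))) =
      -((2 * π * w / d) ^ 2 * exp t) := by
      rw [Real.exp_neg]
      field_simp
    rw [← this]
    push_cast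
    rfl
  rw [hq, ← Complex.ofReal_exp, ← Complex.ofReal_mul]

/-- By Fubini the Gaussian is transformed first; its transform is a multiple of `exp (t / 2) exp
(-α² exp t)` with `α = 2πw/d`, which shifts `κ` by `1/2` and `b` by `α²`. -/
theorem fourier_besselIntegral {κ b d y : ℝ} (hb : 0 ≤ b) (hd : 0 < d) (hy : 0 < y)
    (h : 0 < b ∨ κ + 1 / 2 < 0) (w : ℝ) :
    𝓕 (fun u : ℝ => (besselIntegral κ b (((d * u) ^ 2 + y ^ 2) / 4) : ℂ)) w =
      ((2 * sqrt π / d * besselIntegral (κ + 1 / 2) ((2 * π * w / d) ^ 2 + b) (y ^ 2 / 4) : ℝ) :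
        ℂ) := by
  have hi := integrable_gaussian_prod hb hd hy h
  rw [Real.fourier_real_eq_integral_exp_smul]
  have e1 : ∀ u : ℝ, Complex.exp (↑(-2 * π * u * w) * Complex.I) •
      (besselIntegral κ b (((d * u) ^ 2 + y ^ 2) / 4) : ℂ) =
      ∫ t : ℝ, Complex.exp (↑(-2 * π * u * w) * Complex.I) *
      ((exp (κ * t - b * exp t - ((d * u) ^ 2 + y ^ 2) / 4 * exp (-t)) : ℝ) : ℂ) := by
    intro u
    rw [integral_const_mul, integral_complex_ofReal, smul_eq_mul, besselIntegral]
  simp only [e1]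
  rw [integral_integral_swap]
  · have e2 : ∀ t : ℝ, ∫ u : ℝ, Complex.exp (↑(-2 * π * u * w) * Complex.I) *
      ((exp (κ * t - b * exp t - ((d * u) ^ 2 + y ^ 2) / 4 * exp (-t)) : ℝ) : ℂ) =
      ((2 * sqrt π / d * exp ((κ + 1 / 2) * t - ((2 * π * w / d) ^ 2 + b) * exp t -
        y ^ 2 / 4 * exp (-t)) : ℝ) : ℂ) := by
      intro t
      simp only [besselIntegrand_scaled, Complex.ofReal_mul, mul_left_comm (Complex.exp _)]
      rw [integral_const_mul]
      have := fourier_gaussian_scaled hd w t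
      simp only [Complex.ofReal_mul] at this
      rw [this]
      simp only [← Complex.ofReal_mul]
      congr 1
      rw [mul_assoc, ← exp_add, mul_left_comm, ← exp_add]
      ring_nf
    simp only [e2]
    rw [integral_complex_ofReal, integral_const_mul, besselIntegral]
  · have hm : AEStronglyMeasurable
        (fun p : ℝ × ℝ => Complex.exp (↑(-2 * π * p.1 * w) * Complex.I))
        (volume.prod volume) := Continuous.aestronglyMeasurable (by fun_prop)
    have hn : ∀ p : ℝ × ℝ, ‖Complex.exp (↑(-2 * π * p.1 * w) * Complex.I)‖ ≤ 1 := fun p =>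
      (Complex.norm_exp_ofReal_mul_I _).le
    have hi' : Integrable (fun p : ℝ × ℝ => ((exp (κ * p.2 - b * exp p.2 -
      ((d * p.1) ^ 2 + y ^ 2) / 4 * exp (-p.2)) : ℝ) : ℂ)) (volume.prod volume) := hi.ofReal
    exact hi'.bdd_mul hm (.of_forall hn)


/-! ### Closed forms at half-integer orders -/

section HalfIntegerOrders

variable {b α y : ℝ}

theorem besselIntegral_neg_half_sqrt (hb : 0 ≤ b) (hy : 0 < y) :
    besselIntegral (-(1 / 2)) (α ^ 2 + b) (y ^ 2 / 4) =
      2 * sqrt π / y * exp (-(sqrt (α ^ 2 + b) * y)) := by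
  have h := besselIntegral_neg_half (Real.sqrt_nonneg (α ^ 2 + b)) (half_pos hy)
  rw [Real.sq_sqrt (by positivity)] at h
  rw [show y ^ 2 / 4 = (y / 2) ^ 2 by ring, h, div_div_eq_mul_div,
    show 2 * sqrt (α ^ 2 + b) * (y / 2) = sqrt (α ^ 2 + b) * y by ring]
  ring

/-- When `α² + b = 0` the integral of order `1/2` diverges and the vanishing square root removes it;
this degenerate case is the zero mode of the logarithm. -/
theorem mul_besselIntegral_half_sqrt (hb : 0 ≤ b) (hy : 0 < y) :
    sqrt (α ^ 2 + b) * besselIntegral (1 / 2) (α ^ 2 + b) (y ^ 2 / 4) =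
      if α ^ 2 + b = 0 then 0 else sqrt π * exp (-(sqrt (α ^ 2 + b) * y)) := by
  have hs : 0 ≤ α ^ 2 + b := by positivity
  split_ifs with h0
  · simp [h0]
  · have hpos : 0 < sqrt (α ^ 2 + b) := Real.sqrt_pos.mpr (lt_of_le_of_ne hs (Ne.symm h0))
    have h := besselIntegral_half hpos (half_pos hy)
    rw [Real.sq_sqrt hs, show (y / 2) ^ 2 = y ^ 2 / 4 by ring,
      besselIntegral_neg_half_sqrt hb hy] at h
    rw [h]
    field_simp

theorem sq_mul_besselIntegral_half_sqrt (hb : 0 ≤ b) (hy : 0 < y) :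
    (α ^ 2 + b) * besselIntegral (1 / 2) (α ^ 2 + b) (y ^ 2 / 4) =
      sqrt (α ^ 2 + b) * (sqrt π * exp (-(sqrt (α ^ 2 + b) * y))) := by
  have hs : 0 ≤ α ^ 2 + b := by positivity
  have h := mul_besselIntegral_half_sqrt (α := α) hb hy
  nth_rewrite 1 [← Real.mul_self_sqrt hs]
  rw [mul_assoc, h]
  split_ifs with h0
  · simp [h0]
  · rfl

/-- The recurrence at `κ = -1/2` trades the order `-3/2` for `1/2` and cancels the order `-1/2`. The
left side is what the transform of `potentialYY` leads to. -/
theorem besselIntegral_neg_three_halves (hb : 0 ≤ b) (hy : 0 < y) :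
    -(1 / 4) * besselIntegral (-(1 / 2)) (α ^ 2 + b) (y ^ 2 / 4) +
      y ^ 2 / 8 * besselIntegral (-(3 / 2)) (α ^ 2 + b) (y ^ 2 / 4) =
      sqrt (α ^ 2 + b) * (sqrt π * exp (-(sqrt (α ^ 2 + b) * y))) / 2 := by
  have h := besselIntegral_recurrence (κ := -(1 / 2)) (b := α ^ 2 + b) (c := y ^ 2 / 4)
    (by positivity) (by positivity) (.inr (by norm_num))
  norm_num at h
  have h2 := sq_mul_besselIntegral_half_sqrt (α := α) hb hy
  norm_num at h2 ⊢
  linear_combination h / 2 + h2 / 2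

end HalfIntegerOrders

/-! ### Decay and Fourier transforms of the second derivatives -/

section Potentials

variable {b d y : ℝ}

/-- This is `Δ K₀(√b r) = b K₀(√b r)`, or harmonicity of `log r` at `b = 0`; it is the recurrence at
`κ = -1`. -/
theorem potentialXX_eq (hb : 0 ≤ b) (hy : 0 < y) (x : ℝ) :
    potentialXX b x y =
      -potentialYY b x y + b / 2 * besselIntegral 0 b ((x ^ 2 + y ^ 2) / 4) := by
  have h := besselIntegral_recurrence (κ := -1) (c := (x ^ 2 + y ^ 2) / 4) hb (by positivity)
    (.inr (by norm_num))
  norm_num at h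
  rw [potentialXX, potentialYY]
  linear_combination h / 2

theorem besselIntegral_neg_one_le (hb : 0 ≤ b) {s : ℝ} (hs : 0 < s) :
    besselIntegral (-1) b (s / 4) ≤ 4 / s := by
  refine (besselIntegral_le_zero hb (by positivity) (by norm_num)).trans_eq ?_
  rw [besselIntegral_neg_one_zero (by positivity)]
  field_simp

theorem besselIntegral_neg_two_le (hb : 0 ≤ b) {s : ℝ} (hs : 0 < s) :
    besselIntegral (-2) b (s / 4) ≤ 16 / s ^ 2 := by
  refine (besselIntegral_le_zero hb (by positivity) (by norm_num)).trans_eq ?_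
  rw [besselIntegral_neg_two_zero (by positivity)]
  field_simp
  norm_num

theorem abs_potential_le_aux (hb : 0 ≤ b) {s z : ℝ} (hs : 0 < s) (hz0 : 0 ≤ z) (hz : z ≤ s) :
    |-(1 / 4) * besselIntegral (-1) b (s / 4) + z / 8 * besselIntegral (-2) b (s / 4)| ≤
      3 / s := by
  have h1 := besselIntegral_neg_one_le hb hs
  have h2 := besselIntegral_neg_two_le hb hs
  have n1 := besselIntegral_nonneg (-1) b (s / 4)
  have n2 := besselIntegral_nonneg (-2) b (s / 4)
  have h3 : z / 8 * besselIntegral (-2) b (s / 4) ≤ s / 8 * (16 / s ^ 2) := by gcongr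
  have h4 : 0 ≤ z / 8 * besselIntegral (-2) b (s / 4) := by positivity
  have e : s / 8 * (16 / s ^ 2) = 2 / s := by field_simp; norm_num
  have e2 : 3 / s = 2 / s + 4 / s / 4 := by field_simp; norm_num
  rw [abs_le]
  constructor <;> linarith

theorem abs_potentialYY_le (hb : 0 ≤ b) (hy : 0 < y) (x : ℝ) :
    |potentialYY b x y| ≤ 3 / (x ^ 2 + y ^ 2) :=
  abs_potential_le_aux hb (by positivity) (sq_nonneg y) (by nlinarith [sq_nonneg x])

theorem abs_potentialXX_le (hb : 0 ≤ b) (hy : 0 < y) (x : ℝ) :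
    |potentialXX b x y| ≤ 3 / (x ^ 2 + y ^ 2) :=
  abs_potential_le_aux hb (by positivity) (sq_nonneg x) (by nlinarith [sq_nonneg y])

theorem abs_potentialXY_le (hb : 0 ≤ b) (hy : 0 < y) (x : ℝ) :
    |potentialXY b x y| ≤ 1 / (x ^ 2 + y ^ 2) := by
  have hs : 0 < x ^ 2 + y ^ 2 := by positivity
  have h2 := besselIntegral_neg_two_le hb hs
  have n2 := besselIntegral_nonneg (-2) b ((x ^ 2 + y ^ 2) / 4)
  have hxy : |x * y / 8| ≤ (x ^ 2 + y ^ 2) / 16 := by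
    rw [abs_le]
    constructor <;> nlinarith [sq_nonneg (x + y), sq_nonneg (x - y)]
  rw [potentialXY, abs_mul, abs_of_nonneg n2]
  calc _ ≤ (x ^ 2 + y ^ 2) / 16 * (16 / (x ^ 2 + y ^ 2) ^ 2) := by gcongr
    _ = _ := by field_simp

theorem hasDerivAt_besselIntegral_sq {κ : ℝ} (hb : 0 ≤ b) (hy : 0 < y) (h : 0 < b ∨ κ < 0)
    (u : ℝ) :
    HasDerivAt (fun u => besselIntegral κ b (((d * u) ^ 2 + y ^ 2) / 4))
      (-(d ^ 2 * u / 2) * besselIntegral (κ - 1) b (((d * u) ^ 2 + y ^ 2) / 4)) u := by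
  have h1 : HasDerivAt (fun u => (d * u) ^ 2 + y ^ 2) (2 * (d * u) * d) u := by
    simpa using (((hasDerivAt_id u).const_mul d).pow 2).add_const (y ^ 2)
  have h2 := (hasDerivAt_besselIntegral_div_four hb
    (by positivity : 0 < (d * u) ^ 2 + y ^ 2) h).comp u h1
  exact h2.congr_deriv (by ring)

theorem continuous_besselIntegral_sq {κ : ℝ} (hb : 0 ≤ b) (hy : 0 < y) (h : 0 < b ∨ κ < 0) :
    Continuous fun u => besselIntegral κ b (((d * u) ^ 2 + y ^ 2) / 4) :=
  continuous_iff_continuousAt.mpr fun u => (hasDerivAt_besselIntegral_sq hb hy h u).continuousAt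

theorem fourier_linear_combination {f g : ℝ → ℝ} (hf : Integrable f) (hg : Integrable g)
    (a c : ℝ) (w : ℝ) :
    𝓕 (fun u => ((a * f u + c * g u : ℝ) : ℂ)) w =
      a * 𝓕 (fun u => (f u : ℂ)) w + c * 𝓕 (fun u => (g u : ℂ)) w := by
  simp only [Real.fourier_real_eq]
  have h1 := ((Real.fourierIntegral_convergent_iff (μ := volume) w).mpr (hf.ofReal (𝕜 := ℂ)))
  have h2 := ((Real.fourierIntegral_convergent_iff (μ := volume) w).mpr (hg.ofReal (𝕜 := ℂ)))
  simp only [RCLike.inner_apply, conj_trivial] at h1 h2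
  rw [← integral_const_mul, ← integral_const_mul]
  simp only [mul_comm w] at h1 h2
  refine Eq.trans ?_ (integral_add (h1.const_mul (a : ℂ)) (h2.const_mul (c : ℂ)))
  congr 1
  ext u
  simp only [Circle.smul_def, smul_eq_mul]
  push_cast
  ring

theorem continuous_potentialYY (hb : 0 ≤ b) (hy : 0 < y) :
    Continuous fun u => potentialYY b (d * u) y :=
  ((continuous_besselIntegral_sq hb hy (.inr (by norm_num))).const_mul _).add
    ((continuous_besselIntegral_sq hb hy (.inr (by norm_num))).const_mul _)

theorem continuous_potentialXX (hb : 0 ≤ b) (hy : 0 < y) :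
    Continuous fun u => potentialXX b (d * u) y :=
  ((continuous_besselIntegral_sq hb hy (.inr (by norm_num))).const_mul _).add
    (Continuous.mul (by fun_prop) (continuous_besselIntegral_sq hb hy (.inr (by norm_num))))

theorem continuous_potentialXY (hb : 0 ≤ b) (hy : 0 < y) :
    Continuous fun u => potentialXY b (d * u) y :=
  Continuous.mul (by fun_prop) (continuous_besselIntegral_sq hb hy (.inr (by norm_num)))

theorem integrable_potentialYY (hb : 0 ≤ b) (hd : 0 < d) (hy : 0 < y) :
    Integrable fun u => potentialYY b (d * u) y :=
  ((integrable_besselIntegral hb hd hy (.inr (by norm_num))).const_mul _).add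
    ((integrable_besselIntegral hb hd hy (.inr (by norm_num))).const_mul _)

theorem integrable_potentialXY (hb : 0 ≤ b) (hd : 0 < d) (hy : 0 < y) :
    Integrable fun u => potentialXY b (d * u) y := by
  -- The majorant `1 / (x² + y²)` is itself a quarter of the order `-1` integral at `b = 0`, already
  -- known to be integrable.
  refine ((integrable_besselIntegral (κ := -1) le_rfl hd hy
    (.inr (by norm_num))).const_mul (1 / 4)).mono'
    (continuous_potentialXY hb hy).aestronglyMeasurable (.of_forall fun u => ?_)
  rw [besselIntegral_neg_one_zero (by positivity), Real.norm_eq_abs]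
  refine (abs_potentialXY_le hb hy (d * u)).trans_eq ?_
  field_simp

theorem fourier_potentialYY (hb : 0 ≤ b) (hd : 0 < d) (hy : 0 < y) (w : ℝ) :
    𝓕 (fun u => (potentialYY b (d * u) y : ℂ)) w =
      ((π / d * (sqrt ((2 * π * w / d) ^ 2 + b) *
        exp (-(sqrt ((2 * π * w / d) ^ 2 + b) * y))) : ℝ) : ℂ) := by
  have i1 := (integrable_besselIntegral (κ := -1) hb hd hy (.inr (by norm_num)))
  have i2 := (integrable_besselIntegral (κ := -2) hb hd hy (.inr (by norm_num)))
  have h := fourier_linear_combination i1 i2 (-(1 / 4)) (y ^ 2 / 8) w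
  have f1 := fourier_besselIntegral (κ := -1) hb hd hy (.inr (by norm_num)) w
  have f2 := fourier_besselIntegral (κ := -2) hb hd hy (.inr (by norm_num)) w
  rw [f1, f2] at h
  simp only [← Complex.ofReal_mul, ← Complex.ofReal_add] at h
  refine h.trans (congrArg _ ?_)
  have key := besselIntegral_neg_three_halves (α := 2 * π * w / d) hb hy
  norm_num at key ⊢
  have hπ := Real.mul_self_sqrt pi_nonneg
  linear_combination 2 * sqrt π / d * key + (sqrt ((2 * π * w / d) ^ 2 + b) *
        exp (-(sqrt ((2 * π * w / d) ^ 2 + b) * y))) / d * hπ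

/-- The factor `x²` is avoided by expressing `potentialXX` through `potentialYY` and the order `0`
integral. At `b = 0` that integral diverges but has coefficient zero, hence the case split. -/
theorem fourier_potentialXX (hb : 0 ≤ b) (hd : 0 < d) (hy : 0 < y) (w : ℝ) :
    𝓕 (fun u => (potentialXX b (d * u) y : ℂ)) w =
      ((π / d * (-(2 * π * w / d) ^ 2 / sqrt ((2 * π * w / d) ^ 2 + b) *
        exp (-(sqrt ((2 * π * w / d) ^ 2 + b) * y))) : ℝ) : ℂ) := by
  have fyy := fourier_potentialYY hb hd hy w
  have hs : 0 ≤ (2 * π * w / d) ^ 2 + b := by positivity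
  set α := 2 * π * w / d with hα
  rcases hb.eq_or_lt with rfl | hb'
  · have e : ∀ u, potentialXX 0 (d * u) y =
        -1 * potentialYY 0 (d * u) y + 0 * (fun _ => 0) u := fun u => by
      rw [potentialXX_eq le_rfl hy]
      ring
    simp only [e]
    have h0 := fourier_linear_combination (integrable_potentialYY le_rfl hd hy)
      (g := fun _ => 0) (integrable_zero _ _ _) (-1) 0 w
    rw [h0, fyy]
    simp only [Complex.ofReal_zero, add_zero, Real.sqrt_sq_eq_abs, zero_mul]
    rw [← sq_abs α, neg_div, pow_two, mul_self_div_self]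
    push_cast
    ring
  · have e : ∀ u, potentialXX b (d * u) y = -1 * potentialYY b (d * u) y +
        b / 2 * besselIntegral 0 b (((d * u) ^ 2 + y ^ 2) / 4) := fun u => by
      rw [potentialXX_eq hb hy]
      ring
    simp only [e]
    rw [fourier_linear_combination (integrable_potentialYY hb hd hy)
      (integrable_besselIntegral hb hd hy (.inl hb')), fyy,
      fourier_besselIntegral hb hd hy (.inl hb'), zero_add]
    simp only [← Complex.ofReal_mul, ← Complex.ofReal_add]
    refine congrArg _ ?_
    have hpos : 0 < sqrt (α ^ 2 + b) := Real.sqrt_pos.mpr (by positivity)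
    have hsq := Real.sq_sqrt hs
    have key := sq_mul_besselIntegral_half_sqrt (α := α) hb hy
    have hπ := Real.mul_self_sqrt pi_nonneg
    have key' : besselIntegral (1 / 2) (α ^ 2 + b) (y ^ 2 / 4) =
        sqrt π * exp (-(sqrt (α ^ 2 + b) * y)) / sqrt (α ^ 2 + b) := by
      rw [eq_div_iff hpos.ne']
      apply mul_left_cancel₀ hpos.ne'
      rw [← key, ← Real.mul_self_sqrt hs, Real.sqrt_mul_self hpos.le]
      ring
    rw [← hα, key']
    generalize exp (-(sqrt (α ^ 2 + b) * y)) = E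
    generalize sqrt (α ^ 2 + b) = ω at *
    have hb2 : b = ω ^ 2 - α ^ 2 := by linarith
    rw [hb2]
    field_simp
    linear_combination E * (ω ^ 2 - α ^ 2) * hπ

/-- `potentialXY` is `-y / (4d)` times the `u`-derivative of the order `-1` integral, so
differentiation becomes multiplication by `2πiw`. -/
theorem fourier_potentialXY (hb : 0 ≤ b) (hd : 0 < d) (hy : 0 < y) (w : ℝ) :
    𝓕 (fun u => (potentialXY b (d * u) y : ℂ)) w =
      -(π / d * (Complex.I * (2 * π * w / d : ℝ) *
        exp (-(sqrt ((2 * π * w / d) ^ 2 + b) * y)))) := by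
  have hderiv : ∀ u : ℝ, HasDerivAt
      (fun u : ℝ => (besselIntegral (-1) b (((d * u) ^ 2 + y ^ 2) / 4) : ℂ))
      ((-(4 * d / y) * potentialXY b (d * u) y : ℝ) : ℂ) u := by
    intro u
    have h := (hasDerivAt_besselIntegral_sq (d := d) (κ := -1) hb hy (.inr (by norm_num))
      u).ofReal_comp
    refine h.congr_deriv (congrArg _ ?_)
    rw [potentialXY]
    norm_num
    field_simp
    ring
  have hdf : deriv (fun u : ℝ => (besselIntegral (-1) b (((d * u) ^ 2 + y ^ 2) / 4) : ℂ)) =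
      fun u => ((-(4 * d / y) * potentialXY b (d * u) y : ℝ) : ℂ) :=
    funext fun u => (hderiv u).deriv
  have i2 := integrable_potentialXY hb hd hy
  have h := congrFun (Real.fourier_deriv
    ((integrable_besselIntegral (κ := -1) hb hd hy (.inr (by norm_num))).ofReal (𝕜 := ℂ))
    (fun u => (hderiv u).differentiableAt)
    (by
      simp only [Complex.coe_algebraMap]
      rw [hdf]
      exact (i2.const_mul _).ofReal)) w
  simp only [Complex.coe_algebraMap] at h
  rw [hdf, fourier_besselIntegral (κ := -1) hb hd hy (.inr (by norm_num))] at h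
  have hl := fourier_linear_combination i2 (integrable_zero ℝ ℝ volume) (-(4 * d / y)) 0 w
  simp only [Complex.ofReal_zero, zero_mul, add_zero] at hl
  rw [hl, show (-1 + 1 / 2 : ℝ) = -(1 / 2) by norm_num, besselIntegral_neg_half_sqrt hb hy] at h
  have hd' : (d : ℂ) ≠ 0 := by exact_mod_cast hd.ne'
  have hy' : (y : ℂ) ≠ 0 := by exact_mod_cast hy.ne'
  have hπ : ((sqrt π : ℝ) : ℂ) * ((sqrt π : ℝ) : ℂ) = π := by
    rw [← Complex.ofReal_mul, Real.mul_self_sqrt pi_nonneg]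
  generalize hE : exp (-(sqrt ((2 * π * w / d) ^ 2 + b) * y)) = E at *
  apply mul_left_cancel₀ (by
    push_cast
    exact neg_ne_zero.mpr (div_ne_zero (mul_ne_zero (by norm_num) hd') hy') :
      ((-(4 * d / y) : ℝ) : ℂ) ≠ 0)
  rw [h]
  push_cast
  rw [smul_eq_mul]
  field_simp
  linear_combination 4 * w * E * hπ

end Potentials


/-! ### Poisson summation over a row -/

theorem summable_pow_natAbs {q : ℝ} (h0 : 0 ≤ q) (h1 : q < 1) :
    Summable fun m : ℤ => q ^ m.natAbs := by
  refine Summable.of_nat_of_neg ?_ ?_ <;> simpa using summable_geometric_of_lt_one h0 h1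

/-- Poisson summation for a real function with quadratic decay. -/
theorem poisson_summation_of_bound {f : ℝ → ℝ} {C d y : ℝ} (hd : 0 < d) (hf : Continuous f)
    (hC : 0 ≤ C) (hbound : ∀ u, |f u| ≤ C / ((d * u) ^ 2 + y ^ 2))
    (hs : Summable fun n : ℤ => 𝓕 (fun u => (f u : ℂ)) n) (x : ℝ) :
    (Summable fun n : ℤ => f (x + n)) ∧
      ((∑' n : ℤ, f (x + n) : ℝ) : ℂ) =
        ∑' n : ℤ, 𝓕 (fun u => (f u : ℂ)) n * Complex.exp (2 * π * Complex.I * n * x) := by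
  have hO : f =O[cocompact ℝ] fun u : ℝ => |u| ^ (-2 : ℝ) := by
    refine Asymptotics.IsBigO.of_bound (C / d ^ 2) ?_
    have h0 : ∀ᶠ u : ℝ in cocompact ℝ, u ≠ 0 := by
      simpa using (isCompact_singleton (x := (0 : ℝ))).compl_mem_cocompact
    filter_upwards [h0] with u hu
    have e : |u| ^ (-2 : ℝ) = 1 / u ^ 2 := by
      rw [Real.rpow_neg (abs_nonneg u), Real.rpow_two, sq_abs, one_div]
    rw [e, Real.norm_eq_abs, Real.norm_of_nonneg (by positivity)]
    refine (hbound u).trans ?_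
    have : C / d ^ 2 * (1 / u ^ 2) = C / ((d * u) ^ 2) := by field_simp
    rw [this]
    gcongr
    nlinarith [sq_nonneg y]
  constructor
  · have ht : Tendsto (fun n : ℤ => x + (n : ℝ)) cofinite (cocompact ℝ) :=
      (Homeomorph.addLeft x).isClosedEmbedding.tendsto_cocompact.comp Int.tendsto_coe_cofinite
    refine summable_of_isBigO ?_ (hO.comp_tendsto ht)
    have := (Real.summable_one_div_int_add_rpow x 2).mpr one_lt_two
    refine this.congr fun n => ?_
    rw [Function.comp_apply, Real.rpow_neg (abs_nonneg _), one_div, add_comm]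
  · have h := Real.tsum_eq_tsum_fourier_of_rpow_decay_of_summable
      (f := fun u => (f u : ℂ)) (by fun_prop) one_lt_two
      (Asymptotics.IsBigO.of_norm_left (by simpa using hO.norm_left)) hs x
    rw [Complex.ofReal_tsum, h]
    congr 1
    ext n
    rw [fourier_coe_apply]
    simp

/-- The matrix of the Fourier mode of frequency `α` decaying like `exp (-ω y)`. -/
noncomputable def modeMatrix (ω α : ℝ) : Matrix (Fin 2) (Fin 2) ℂ :=
  !![(ω : ℂ), Complex.I * α; Complex.I * α, -(α : ℂ) ^ 2 / ω]

theorem norm_modeMatrix_le {ω α : ℝ} (h : |α| ≤ ω) (i j : Fin 2) : ‖modeMatrix ω α i j‖ ≤ ω := by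
  have hω : 0 ≤ ω := (abs_nonneg α).trans h
  have h3 : α ^ 2 / ω ≤ ω := by
    rcases hω.eq_or_lt with rfl | hpos
    · simp
    · rw [div_le_iff₀ hpos, ← sq_abs]
      nlinarith [abs_nonneg α]
  fin_cases i <;> fin_cases j <;> simp [modeMatrix, abs_of_nonneg hω, h, h3]

theorem abs_alpha {d : ℝ} (hd : 0 < d) (m : ℤ) : |alpha d m| = 2 * π / d * m.natAbs := by
  rw [alpha, abs_div, abs_mul, abs_of_pos hd, abs_of_pos (by positivity), Nat.cast_natAbs,
    Int.cast_abs]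
  ring

theorem abs_le_sqrt_sq_add {α b : ℝ} (hb : 0 ≤ b) : |α| ≤ sqrt (α ^ 2 + b) :=
  Real.abs_le_sqrt (by linarith)

/-- Half of the exponential decay absorbs the factor `ω`. -/
theorem mul_exp_neg_le {ω y : ℝ} (hy : 0 < y) :
    ω * exp (-(ω * y)) ≤ 2 / y * exp (-(ω * y / 2)) := by
  have h := Real.add_one_le_exp (ω * y / 2)
  have e : exp (-(ω * y / 2)) = exp (ω * y / 2) * exp (-(ω * y)) := by
    rw [← exp_add]; ring_nf
  rw [e, ← mul_assoc]
  gcongr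
  rw [div_mul_eq_mul_div, le_div_iff₀ hy]
  linarith

theorem summable_modes {b d y : ℝ} (hb : 0 ≤ b) (hd : 0 < d) (hy : 0 < y) (i j : Fin 2) :
    Summable fun m : ℤ => modeMatrix (sqrt (alpha d m ^ 2 + b)) (alpha d m) i j *
      ((exp (-(sqrt (alpha d m ^ 2 + b) * y)) : ℝ) : ℂ) := by
  have hq : exp (-(π * y / d)) < 1 := by
    rw [Real.exp_lt_one_iff]
    have : 0 < π * y / d := by positivity
    linarith
  refine ((summable_pow_natAbs (exp_pos _).le hq).mul_left (2 / y)).of_norm_bounded fun m => ?_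
  have ha := abs_le_sqrt_sq_add (α := alpha d m) hb
  rw [norm_mul, Complex.norm_real, Real.norm_of_nonneg (exp_pos _).le]
  calc _ ≤ sqrt (alpha d m ^ 2 + b) * exp (-(sqrt (alpha d m ^ 2 + b) * y)) := by
        gcongr
        exact norm_modeMatrix_le ha i j
    _ ≤ 2 / y * exp (-(sqrt (alpha d m ^ 2 + b) * y / 2)) := mul_exp_neg_le hy
    _ ≤ 2 / y * exp (-(π * y / d)) ^ m.natAbs := by
        rw [← Real.exp_nat_mul]
        gcongr
        rw [abs_alpha hd] at ha
        have := mul_le_mul_of_nonneg_right ha hy.le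
        have e : 2 * π / d * (m.natAbs : ℝ) * y = 2 * (m.natAbs * (π * y / d)) := by ring
        linarith

/-- The sum of a potential over a row of images, as a Fourier series. -/
theorem row_sum_potentialMatrix {b d y : ℝ} (hb : 0 ≤ b) (hd : 0 < d) (hy : 0 < y) (x : ℝ)
    (i j : Fin 2) :
    (Summable fun m : ℤ => potentialMatrix b (x + d * m, y) i j) ∧
      ((∑' m : ℤ, potentialMatrix b (x + d * m, y) i j : ℝ) : ℂ) =
        ∑' m : ℤ, π / d * (modeMatrix (sqrt (alpha d m ^ 2 + b)) (alpha d m) i j *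
          ((exp (-(sqrt (alpha d m ^ 2 + b) * y)) : ℝ) : ℂ)) *
          Complex.exp (Complex.I * alpha d m * x) := by
  -- The four entries differ only in continuity, decay and transform; the Poisson argument, applied
  -- at `x / d`, is common.
  have main : ∀ V : ℝ → ℝ → ℝ, (Continuous fun u => V (d * u) y) →
      (∀ z, |V z y| ≤ 3 / (z ^ 2 + y ^ 2)) → (∀ m : ℤ, 𝓕 (fun u => (V (d * u) y : ℂ)) (m : ℝ) =
        π / d * (modeMatrix (sqrt (alpha d m ^ 2 + b)) (alpha d m) i j *
          ((exp (-(sqrt (alpha d m ^ 2 + b) * y)) : ℝ) : ℂ))) →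
      (Summable fun m : ℤ => V (x + d * m) y) ∧
      ((∑' m : ℤ, V (x + d * m) y : ℝ) : ℂ) =
        ∑' m : ℤ, π / d * (modeMatrix (sqrt (alpha d m ^ 2 + b)) (alpha d m) i j *
          ((exp (-(sqrt (alpha d m ^ 2 + b) * y)) : ℝ) : ℂ)) *
          Complex.exp (Complex.I * alpha d m * x) := by
    intro V hc hV hF
    have hs : Summable fun m : ℤ => 𝓕 (fun u => (V (d * u) y : ℂ)) (m : ℝ) := by
      simp only [hF]
      exact (summable_modes hb hd hy i j).mul_left _
    obtain ⟨h1, h2⟩ := poisson_summation_of_bound hd hc (by norm_num) (fun u => hV (d * u)) hs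
      (x / d)
    have e : ∀ m : ℤ, d * (x / d + m) = x + d * m := fun m => by field_simp
    simp only [e] at h1 h2
    refine ⟨h1, h2.trans (tsum_congr fun m => ?_)⟩
    rw [hF]
    congr 2
    rw [alpha]
    push_cast
    ring
  have hbd : ∀ z, |-potentialXY b z y| ≤ 3 / (z ^ 2 + y ^ 2) := fun z => by
    rw [abs_neg]
    refine (abs_potentialXY_le hb hy z).trans ?_
    gcongr
    norm_num
  have hFXY : ∀ m : ℤ, 𝓕 (fun u => ((-potentialXY b (d * u) y : ℝ) : ℂ)) (m : ℝ) =
      π / d * (Complex.I * alpha d m *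
        ((exp (-(sqrt (alpha d m ^ 2 + b) * y)) : ℝ) : ℂ)) := fun m => by
    have h := fourier_linear_combination (integrable_potentialXY hb hd hy)
      (g := fun _ => 0) (integrable_zero _ _ _) (-1) 0 (m : ℝ)
    simp only [neg_one_mul, mul_zero, add_zero, Complex.ofReal_zero, zero_mul] at h
    rw [h, fourier_potentialXY hb hd hy, alpha]
    push_cast
    ring
  fin_cases i <;> fin_cases j
  · refine main (potentialYY b) (continuous_potentialYY hb hy) (abs_potentialYY_le hb hy)
      fun m => ?_
    rw [fourier_potentialYY hb hd hy]
    simp [modeMatrix, alpha]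
  · refine main (fun z y => -potentialXY b z y) (continuous_potentialXY hb hy).neg hbd
      fun m => ?_
    rw [hFXY]
    simp [modeMatrix]
  · refine main (fun z y => -potentialXY b z y) (continuous_potentialXY hb hy).neg hbd
      fun m => ?_
    rw [hFXY]
    simp [modeMatrix]
  · refine main (potentialXX b) (continuous_potentialXX hb hy) (abs_potentialXX_le hb hy)
      fun m => ?_
    rw [fourier_potentialXX hb hd hy]
    simp [modeMatrix, alpha]


/-! ### Fourier modes of a row of Stokeslets -/

/-- The Fourier mode `m` of a row of images at height `y` below the target. -/
noncomputable def modeTerm (β d : ℝ) (m : ℤ) (x y : ℝ) (i j : Fin 2) : ℂ :=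
  1 / (2 * (β : ℂ) ^ 2 * d) *
    (modeMatrix (chi β d m) (alpha d m) i j * ((exp (-(chi β d m * y)) : ℝ) : ℂ) -
      modeMatrix |alpha d m| (alpha d m) i j * ((exp (-(|alpha d m| * y)) : ℝ) : ℂ)) *
    Complex.exp (Complex.I * alpha d m * x)

theorem norm_exp_I_mul (a x : ℝ) : ‖Complex.exp (Complex.I * a * x)‖ = 1 := by
  rw [mul_assoc, mul_comm, ← Complex.ofReal_mul, Complex.norm_exp_ofReal_mul_I]

theorem row_sum_stokeslet {β d y : ℝ} (hβ : 0 < β) (hd : 0 < d) (hy : 0 < y) (x : ℝ)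
    (i j : Fin 2) :
    (Summable fun m : ℤ => modifiedStokeslet β (x + d * m, y) i j) ∧
      ((∑' m : ℤ, modifiedStokeslet β (x + d * m, y) i j : ℝ) : ℂ) =
        ∑' m : ℤ, modeTerm β d m x y i j := by
  obtain ⟨s1, t1⟩ := row_sum_potentialMatrix (sq_nonneg β) hd hy x i j
  obtain ⟨s0, t0⟩ := row_sum_potentialMatrix le_rfl hd hy x i j
  have e : ∀ m : ℤ, modifiedStokeslet β (x + d * m, y) i j =
      1 / (2 * π * β ^ 2) * (potentialMatrix (β ^ 2) (x + d * m, y) i j -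
        potentialMatrix 0 (x + d * m, y) i j) := fun m => by
    rw [modifiedStokeslet_eq hβ hy.ne', Matrix.smul_apply, Matrix.sub_apply, smul_eq_mul]
  have hmod : ∀ b : ℝ, 0 ≤ b → Summable fun m : ℤ =>
      (π / d * (modeMatrix (sqrt (alpha d m ^ 2 + b)) (alpha d m) i j *
          ((exp (-(sqrt (alpha d m ^ 2 + b) * y)) : ℝ) : ℂ)) *
          Complex.exp (Complex.I * alpha d m * x) : ℂ) := fun b hb => by
    refine ((summable_modes hb hd hy i j).norm.mul_left (π / d)).of_norm_bounded fun m => ?_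
    rw [norm_mul, norm_exp_I_mul, mul_one, norm_mul, norm_div, Complex.norm_real,
      Complex.norm_real, Real.norm_of_nonneg pi_nonneg, Real.norm_of_nonneg hd.le]
  simp only [e]
  refine ⟨(s1.sub s0).mul_left _, ?_⟩
  rw [tsum_mul_left, s1.tsum_sub s0, Complex.ofReal_mul, Complex.ofReal_sub, t1, t0,
    ← (hmod _ (sq_nonneg β)).tsum_sub (hmod _ le_rfl), ← tsum_mul_left]
  refine tsum_congr fun m => ?_
  rw [modeTerm, chi, add_zero, Real.sqrt_sq_eq_abs]
  have hπ : (π : ℂ) ≠ 0 := by exact_mod_cast pi_ne_zero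
  have hd' : (d : ℂ) ≠ 0 := by exact_mod_cast hd.ne'
  have hβ' : (β : ℂ) ≠ 0 := by exact_mod_cast hβ.ne'
  push_cast
  field_simp

theorem imageTerm_eq (β d ξ η : ℝ) (t s : ℝ × ℝ) (m n : ℤ) :
    imageTerm β d ξ η t s m n =
      modifiedStokeslet β (t.1 - s.1 - n * ξ + d * (-m : ℤ), t.2 - s.2 - n * η) := by
  rw [imageTerm]
  congr 1
  ext <;> simp [latticeVector] <;> ring

theorem row_sum_imageTerm {β d ξ η : ℝ} (hβ : 0 < β) (hd : 0 < d) {t s : ℝ × ℝ} {n : ℤ}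
    (hn : 0 < t.2 - s.2 - n * η) (i j : Fin 2) :
    (Summable fun m : ℤ => imageTerm β d ξ η t s m n i j) ∧
      ((∑' m : ℤ, imageTerm β d ξ η t s m n i j : ℝ) : ℂ) =
        ∑' m : ℤ, modeTerm β d m (t.1 - s.1 - n * ξ) (t.2 - s.2 - n * η) i j := by
  obtain ⟨h1, h2⟩ := row_sum_stokeslet hβ hd hn (t.1 - s.1 - n * ξ) i j
  simp only [imageTerm_eq]
  refine ⟨(Equiv.neg ℤ).summable_iff.mpr h1, ?_⟩
  rw [← h2]
  congr 1
  exact (Equiv.neg ℤ).tsum_eq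
    (fun m : ℤ => modifiedStokeslet β (t.1 - s.1 - n * ξ + d * m, t.2 - s.2 - n * η) i j)

/-! ### Mode bounds -/

section Bounds

theorem exp_sub_exp_le {a χ y : ℝ} :
    exp (-(a * y)) - exp (-(χ * y)) ≤ (χ - a) * y * exp (-(a * y)) := by
  have h := Real.add_one_le_exp (-((χ - a) * y))
  have e : exp (-(χ * y)) = exp (-((χ - a) * y)) * exp (-(a * y)) := by
    rw [← exp_add]; ring_nf
  rw [e]
  nlinarith [exp_pos (-(a * y))]

/-- With `χ = sqrt (α² + β²)`, both the matrix entries and the exponentials differ by a multiple of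
`χ - |α| ≤ β² / (2|α|)`. The resulting factor `β²` cancels the prefactor of the Stokeslet, so the
limit `β → 0` is harmless. -/
theorem norm_modeMatrix_sub_le {α β y : ℝ} (hα : α ≠ 0) (hy : 0 ≤ y) (i j : Fin 2) :
    ‖modeMatrix (sqrt (α ^ 2 + β ^ 2)) α i j * ((exp (-(sqrt (α ^ 2 + β ^ 2) * y)) : ℝ) : ℂ) -
      modeMatrix |α| α i j * ((exp (-(|α| * y)) : ℝ) : ℂ)‖ ≤
      β ^ 2 * (1 / (2 * |α|) + y / 2) * exp (-(|α| * y)) := by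
  have haχ : |α| ≤ sqrt (α ^ 2 + β ^ 2) := abs_le_sqrt_sq_add (sq_nonneg β)
  have hχ2 : sqrt (α ^ 2 + β ^ 2) ^ 2 = |α| ^ 2 + β ^ 2 := by
    rw [Real.sq_sqrt (by positivity), sq_abs]
  have ha : 0 < |α| := abs_pos.mpr hα
  have hsq : α ^ 2 = |α| ^ 2 := (sq_abs α).symm
  generalize sqrt (α ^ 2 + β ^ 2) = χ at *
  have hχ : 0 < χ := ha.trans_le haχ
  have hdiff : χ - |α| ≤ β ^ 2 / (2 * |α|) := by
    rw [le_div_iff₀ (by positivity)]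
    nlinarith
  have hdiff0 : 0 ≤ χ - |α| := by linarith
  have hE := exp_sub_exp_le (a := |α|) (χ := χ) (y := y)
  have hE' : exp (-(χ * y)) ≤ exp (-(|α| * y)) := by
    apply Real.exp_le_exp.mpr
    nlinarith
  have p1 := exp_pos (-(χ * y))
  have p2 := exp_pos (-(|α| * y))
  have hrhs : β ^ 2 * (1 / (2 * |α|) + y / 2) * exp (-(|α| * y)) =
      β ^ 2 / (2 * |α|) * exp (-(|α| * y)) +
        |α| * (β ^ 2 / (2 * |α|) * y * exp (-(|α| * y))) := by
    field_simp
  have b1 : |α| * (exp (-(|α| * y)) - exp (-(χ * y))) ≤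
      |α| * (β ^ 2 / (2 * |α|) * y * exp (-(|α| * y))) := by
    have : (χ - |α|) * y * exp (-(|α| * y)) ≤ β ^ 2 / (2 * |α|) * y * exp (-(|α| * y)) := by
      gcongr
    exact mul_le_mul_of_nonneg_left (hE.trans this) ha.le
  have b0 : 0 ≤ |α| * (exp (-(|α| * y)) - exp (-(χ * y))) :=
    mul_nonneg ha.le (by linarith)
  have b2 : (χ - |α|) * exp (-(χ * y)) ≤ β ^ 2 / (2 * |α|) * exp (-(|α| * y)) := by
    gcongr
  have b3 : 0 ≤ (χ - |α|) * exp (-(χ * y)) := by positivity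
  have b4 : 0 ≤ β ^ 2 / (2 * |α|) * exp (-(|α| * y)) := by positivity
  rw [hrhs]
  have off : ‖Complex.I * (α : ℂ) * ((exp (-(χ * y)) : ℝ) : ℂ) -
      Complex.I * (α : ℂ) * ((exp (-(|α| * y)) : ℝ) : ℂ)‖ ≤
      β ^ 2 / (2 * |α|) * exp (-(|α| * y)) +
        |α| * (β ^ 2 / (2 * |α|) * y * exp (-(|α| * y))) := by
    rw [← mul_sub, norm_mul, norm_mul, Complex.norm_I, one_mul, ← Complex.ofReal_sub,
      Complex.norm_real, Complex.norm_real, Real.norm_eq_abs, Real.norm_eq_abs,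
      abs_sub_comm, abs_of_nonneg (by linarith : 0 ≤ exp (-(|α| * y)) - exp (-(χ * y)))]
    linarith
  fin_cases i <;> fin_cases j
  · change ‖(χ : ℂ) * ((exp (-(χ * y)) : ℝ) : ℂ) -
      ((|α| : ℝ) : ℂ) * ((exp (-(|α| * y)) : ℝ) : ℂ)‖ ≤ _
    rw [← Complex.ofReal_mul, ← Complex.ofReal_mul, ← Complex.ofReal_sub, Complex.norm_real,
      Real.norm_eq_abs, abs_le]
    constructor <;> nlinarith
  · exact off
  · exact off
  · change ‖-(α : ℂ) ^ 2 / (χ : ℂ) * ((exp (-(χ * y)) : ℝ) : ℂ) -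
      -(α : ℂ) ^ 2 / ((|α| : ℝ) : ℂ) * ((exp (-(|α| * y)) : ℝ) : ℂ)‖ ≤ _
    rw [← Complex.ofReal_pow, ← Complex.ofReal_neg, ← Complex.ofReal_div, ← Complex.ofReal_div,
      ← Complex.ofReal_mul, ← Complex.ofReal_mul, ← Complex.ofReal_sub, Complex.norm_real,
      Real.norm_eq_abs, hsq]
    have e1 : -|α| ^ 2 / |α| = -|α| := by field_simp
    have e2 : -|α| ^ 2 / χ = -|α| + |α| / χ * (χ - |α|) := by field_simp; ring
    have hr : |α| / χ ≤ 1 := (div_le_one hχ).mpr haχ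
    have hr0 : 0 ≤ |α| / χ := by positivity
    have b5 : |α| / χ * ((χ - |α|) * exp (-(χ * y))) ≤ (χ - |α|) * exp (-(χ * y)) :=
      mul_le_of_le_one_left b3 hr
    have b6 : 0 ≤ |α| / χ * ((χ - |α|) * exp (-(χ * y))) := mul_nonneg hr0 b3
    rw [e1, e2, abs_le]
    constructor <;> nlinarith

theorem norm_modeTerm_eq {β d : ℝ} (hd : 0 < d) (m : ℤ) (x y : ℝ) (i j : Fin 2) :
    ‖modeTerm β d m x y i j‖ = 1 / (2 * β ^ 2 * d) *
      ‖modeMatrix (chi β d m) (alpha d m) i j * ((exp (-(chi β d m * y)) : ℝ) : ℂ) -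
      modeMatrix |alpha d m| (alpha d m) i j * ((exp (-(|alpha d m| * y)) : ℝ) : ℂ)‖ := by
  rw [modeTerm, norm_mul, norm_exp_I_mul, mul_one, norm_mul]
  congr 1
  have : (1 / (2 * (β : ℂ) ^ 2 * d)) = ((1 / (2 * β ^ 2 * d) : ℝ) : ℂ) := by push_cast; rfl
  rw [this, Complex.norm_real, Real.norm_of_nonneg (by positivity)]

/-- A bound uniform in `β` for the nonzero modes of the `k`-th row. -/
theorem norm_modeTerm_le {β d η y : ℝ} {k : ℕ} {m : ℤ} (hβ : 0 < β) (hd : 0 < d) (hη : 0 < η)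
    (hηd : η ≤ d) (hm : m ≠ 0) (hy1 : k * η ≤ y) (hy2 : y ≤ (k + 2) * η) (x : ℝ) (i j : Fin 2) :
    ‖modeTerm β d m x y i j‖ ≤ (k + 3) * exp (-(2 * π * η / d)) ^ (m.natAbs * k) := by
  have hm1 : (1 : ℝ) ≤ m.natAbs := by
    exact_mod_cast Int.natAbs_pos.mpr hm
  have hα := abs_alpha hd m
  have hα0 : 0 < |alpha d m| := by rw [hα]; positivity
  have hy0 : 0 ≤ y := le_trans (by positivity) hy1
  rw [norm_modeTerm_eq hd]
  have h := norm_modeMatrix_sub_le (β := β) (abs_pos.mp hα0) hy0 i j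
  rw [← chi] at h
  have e1 : exp (-(|alpha d m| * y)) ≤ exp (-(2 * π * η / d)) ^ (m.natAbs * k) := by
    rw [← Real.exp_nat_mul]
    apply Real.exp_le_exp.mpr
    have := mul_le_mul_of_nonneg_left hy1 hα0.le
    rw [hα] at this ⊢
    have e : 2 * π / d * m.natAbs * (k * η) = ((m.natAbs * k : ℕ) : ℝ) * (2 * π * η / d) := by
      push_cast; ring
    linarith
  -- Once `β²` cancels, the coefficient is `1 / (8π|m|) + y / (4d)`, bounded by `1 + (k + 2)`; the
  -- second summand needs `η ≤ d`.
  have h4 : 1 / (4 * (2 * π * m.natAbs)) ≤ 1 := by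
    rw [div_le_one (by positivity)]
    nlinarith [Real.pi_gt_three]
  have h5 : y / (4 * d) ≤ k + 2 := by
    rw [div_le_iff₀ (by positivity)]
    have hk : (0 : ℝ) ≤ k := k.cast_nonneg
    nlinarith
  calc _ ≤ 1 / (2 * β ^ 2 * d) * (β ^ 2 * (1 / (2 * |alpha d m|) + y / 2) *
        exp (-(|alpha d m| * y))) := by gcongr
    _ = (1 / (4 * (2 * π * m.natAbs)) + y / (4 * d)) * exp (-(|alpha d m| * y)) := by
        rw [hα]
        field_simp
        norm_num
    _ ≤ (k + 3) * exp (-(2 * π * η / d)) ^ (m.natAbs * k) := by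
        exact mul_le_mul (by linarith) e1 (exp_pos _).le (by positivity)

/-- Not uniform in `β` and `d`. It serves only for summability, because the truncated expansion
always retains the zero mode. -/
theorem norm_modeTerm_zero_le {β d η y : ℝ} {k : ℕ} (hβ : 0 < β) (hd : 0 < d)
    (hy1 : k * η ≤ y) (x : ℝ) (i j : Fin 2) :
    ‖modeTerm β d 0 x y i j‖ ≤ 1 / (2 * β * d) * exp (-(β * η)) ^ k := by
  rw [norm_modeTerm_eq hd]
  have hα : alpha d 0 = 0 := by simp [alpha]
  have hχ : chi β d 0 = β := by rw [chi, hα]; simp [hβ.le]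
  have h0 : modeMatrix 0 0 i j = 0 := by
    fin_cases i <;> fin_cases j <;> simp [modeMatrix]
  have h1 := norm_modeMatrix_le (α := 0) (ω := β) (by simpa using hβ.le) i j
  rw [hα, hχ, abs_zero, h0, zero_mul, sub_zero, norm_mul, Complex.norm_real,
    Real.norm_of_nonneg (exp_pos _).le]
  have e1 : exp (-(β * y)) ≤ exp (-(β * η)) ^ k := by
    rw [← Real.exp_nat_mul]
    apply Real.exp_le_exp.mpr
    nlinarith
  calc _ ≤ 1 / (2 * β ^ 2 * d) * (β * exp (-(β * η)) ^ k) := by gcongr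
    _ = _ := by field_simp

end Bounds


/-! ### Geometric summation over the rows -/

/-- The contribution of the mode `m` to the low-rank expansion of the south kernel at
displacement `p`. -/
noncomputable def expansionTerm (β d ξ η : ℝ) (m : ℤ) (p : ℝ × ℝ) (i j : Fin 2) : ℂ :=
  Complex.exp (Complex.I * alpha d m * p.1) *
    (((exp (-(chi β d m * p.2)) : ℝ) : ℂ) * blockBetaSouth β d ξ η m i j +
      ((exp (-(|alpha d m| * p.2)) : ℝ) : ℂ) * blockSouth β d ξ η m i j)

theorem hasSum_exp_neg {Q : ℂ} (hQ : 0 < Q.re) :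
    HasSum (fun k : ℕ => Complex.exp (-((k + 2 : ℕ) * Q)))
      (Complex.exp (-2 * Q) / (1 - Complex.exp (-Q))) := by
  have h : ‖Complex.exp (-Q)‖ < 1 := by
    rw [Complex.norm_exp, Complex.neg_re, Real.exp_lt_one_iff]
    linarith
  have := (hasSum_geometric_of_norm_lt_one h).mul_left (Complex.exp (-2 * Q))
  rw [div_eq_mul_inv]
  refine this.congr_fun fun k => ?_
  rw [← Complex.exp_nat_mul, ← Complex.exp_add]
  congr 1
  push_cast
  ring

theorem exp_row_shift (ω α x y ξ η : ℝ) (k : ℕ) :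
    ((exp (-(ω * (y + k * η))) : ℝ) : ℂ) * Complex.exp (Complex.I * α * (x + k * ξ : ℝ)) =
      Complex.exp (Complex.I * α * x) * ((exp (-(ω * y)) : ℝ) : ℂ) *
        Complex.exp (-(k * (ω * η - Complex.I * α * ξ))) := by
  push_cast
  rw [← Complex.exp_add, ← Complex.exp_add, ← Complex.exp_add]
  ring_nf

theorem alpha_ne_zero {d : ℝ} (hd : 0 < d) {m : ℤ} (hm : m ≠ 0) : alpha d m ≠ 0 := by
  have : (m : ℝ) ≠ 0 := by exact_mod_cast hm
  rw [alpha]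
  positivity

/-- Each further row multiplies the two exponentials of the mode by `exp (-QBeta)` and `exp
(-QZero)`; the series start at exponent `2` because the nearest row is `n = -2`. -/
theorem hasSum_modeTerm {β d ξ η : ℝ} (hβ : 0 < β) (hd : 0 < d) (hη : 0 < η) (m : ℤ)
    (p : ℝ × ℝ) (i j : Fin 2) :
    HasSum (fun k : ℕ => modeTerm β d m (p.1 + (k + 2 : ℕ) * ξ) (p.2 + (k + 2 : ℕ) * η) i j)
      (expansionTerm β d ξ η m p i j) := by
  have hχ : 0 < chi β d m := Real.sqrt_pos.mpr (by positivity)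
  have hQβ : 0 < (QBeta β d ξ η m).re := by
    simp only [QBeta, Complex.sub_re, Complex.mul_re, Complex.ofReal_re, Complex.ofReal_im,
      Complex.I_re, Complex.I_im, Complex.mul_im]
    have := mul_pos hχ hη
    linarith
  have hβm : blockBetaSouth β d ξ η m i j = 1 / (2 * (β : ℂ) ^ 2 * d) *
      modeMatrix (chi β d m) (alpha d m) i j *
      (Complex.exp (-2 * QBeta β d ξ η m) / (1 - Complex.exp (-QBeta β d ξ η m))) := by
    rw [blockBetaSouth, Matrix.smul_apply, smul_eq_mul, ← modeMatrix]
    ring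
  have h1 := ((hasSum_exp_neg hQβ).mul_left (Complex.exp (Complex.I * alpha d m * p.1) *
    ((exp (-(chi β d m * p.2)) : ℝ) : ℂ) * (1 / (2 * (β : ℂ) ^ 2 * d) *
      modeMatrix (chi β d m) (alpha d m) i j)))
  have h2 : HasSum (fun k : ℕ => Complex.exp (Complex.I * alpha d m * p.1) *
      ((exp (-(|alpha d m| * p.2)) : ℝ) : ℂ) * (-(1 / (2 * (β : ℂ) ^ 2 * d) *
      modeMatrix |alpha d m| (alpha d m) i j)) *
      Complex.exp (-((k + 2 : ℕ) * QZero d ξ η m)))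
      (Complex.exp (Complex.I * alpha d m * p.1) *
      ((exp (-(|alpha d m| * p.2)) : ℝ) : ℂ) * blockSouth β d ξ η m i j) := by
    -- At `m = 0` the ratio is `1` and the geometric series would diverge, but the matrix vanishes
    -- (with `0 / 0 = 0` in its last entry).
    by_cases hm : m = 0
    · subst hm
      have h0 : modeMatrix |alpha d 0| (alpha d 0) i j = 0 := by
        fin_cases i <;> fin_cases j <;> simp [modeMatrix, alpha]
      simp only [h0, blockSouth, if_true, Matrix.zero_apply, mul_zero, neg_zero, zero_mul]
      exact hasSum_zero
    · have hα : 0 < |alpha d m| := abs_pos.mpr (alpha_ne_zero hd hm)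
      have hQ : 0 < (QZero d ξ η m).re := by
        simp only [QZero, Complex.sub_re, Complex.mul_re, Complex.ofReal_re, Complex.ofReal_im,
          Complex.I_re, Complex.I_im, Complex.mul_im]
        have := mul_pos hα hη
        linarith
      have hα' : ((|alpha d m| : ℝ) : ℂ) ≠ 0 := by exact_mod_cast hα.ne'
      have hsq : (alpha d m : ℂ) ^ 2 = ((|alpha d m| : ℝ) : ℂ) ^ 2 := by
        rw [← Complex.ofReal_pow, ← Complex.ofReal_pow, sq_abs]
      have hmat : !![-((|alpha d m| : ℝ) : ℂ), -(Complex.I * alpha d m);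
          -(Complex.I * alpha d m), ((|alpha d m| : ℝ) : ℂ)] =
          -modeMatrix |alpha d m| (alpha d m) := by
        ext i j
        fin_cases i <;> fin_cases j <;> simp [modeMatrix, hsq]
        field_simp
      have hb : blockSouth β d ξ η m i j = -(1 / (2 * (β : ℂ) ^ 2 * d) *
          modeMatrix |alpha d m| (alpha d m) i j) *
          (Complex.exp (-2 * QZero d ξ η m) / (1 - Complex.exp (-QZero d ξ η m))) := by
        rw [blockSouth, if_neg hm, hmat, Matrix.smul_apply, smul_eq_mul, Matrix.neg_apply]
        ring
      rw [hb, ← mul_assoc]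
      exact (hasSum_exp_neg hQ).mul_left _
  have h := h1.add h2
  have ht : expansionTerm β d ξ η m p i j = Complex.exp (Complex.I * alpha d m * p.1) *
      ((exp (-(chi β d m * p.2)) : ℝ) : ℂ) * (1 / (2 * (β : ℂ) ^ 2 * d) *
      modeMatrix (chi β d m) (alpha d m) i j) *
      (Complex.exp (-2 * QBeta β d ξ η m) / (1 - Complex.exp (-QBeta β d ξ η m))) +
      Complex.exp (Complex.I * alpha d m * p.1) *
      ((exp (-(|alpha d m| * p.2)) : ℝ) : ℂ) * blockSouth β d ξ η m i j := by
    rw [expansionTerm, hβm]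
    ring
  rw [ht]
  refine h.congr_fun fun k => ?_
  have s1 := exp_row_shift (chi β d m) (alpha d m) p.1 p.2 ξ η (k + 2)
  have s2 := exp_row_shift |alpha d m| (alpha d m) p.1 p.2 ξ η (k + 2)
  rw [modeTerm, QBeta, QZero]
  linear_combination (1 / (2 * (β : ℂ) ^ 2 * d) * modeMatrix (chi β d m) (alpha d m) i j) * s1 -
    (1 / (2 * (β : ℂ) ^ 2 * d) * modeMatrix |alpha d m| (alpha d m) i j) * s2

theorem summable_add_mul_pow {r : ℝ} (h0 : 0 ≤ r) (h1 : r < 1) :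
    Summable fun k : ℕ => ((k : ℝ) + 4) * r ^ k := by
  have h := summable_pow_mul_geometric_of_norm_lt_one 1 (r := r)
    (by rwa [Real.norm_of_nonneg h0])
  refine (h.add ((summable_geometric_of_lt_one h0 h1).mul_left 4)).congr fun k => ?_
  ring

section Displacement

variable {β d ξ η : ℝ} {p : ℝ × ℝ}

/-- Since `|p.2| ≤ η`, the row `k + 2` lies at height between `(k + 1) η` and `(k + 3) η`. -/
theorem norm_modeTerm_row_le (hβ : 0 < β) (hd : 0 < d) (hη : 0 < η) (hηd : η ≤ d)
    (hp : |p.2| ≤ η) {m : ℤ} (hm : m ≠ 0) (k : ℕ) (i j : Fin 2) :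
    ‖modeTerm β d m (p.1 + (k + 2 : ℕ) * ξ) (p.2 + (k + 2 : ℕ) * η) i j‖ ≤
      (k + 4) * exp (-(2 * π * η / d)) ^ (m.natAbs * (k + 1)) := by
  have := abs_le.mp hp
  refine (norm_modeTerm_le (η := η) (k := k + 1) hβ hd hη hηd hm ?_ ?_ _ i j).trans_eq ?_
  · push_cast; linarith
  · push_cast; linarith
  · push_cast; ring

theorem exp_neg_period_lt_one (hd : 0 < d) (hη : 0 < η) : exp (-(2 * π * η / d)) < 1 := by
  rw [Real.exp_lt_one_iff]
  have : 0 < 2 * π * η / d := by positivity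
  linarith

theorem summable_prod_pow_natAbs {f : ℕ → ℝ} {q : ℝ} (hf : Summable f) (hf0 : ∀ k, 0 ≤ f k)
    (h0 : 0 ≤ q) (h1 : q < 1) : Summable fun a : ℕ × ℤ => f a.1 * q ^ a.2.natAbs :=
  hf.mul_of_nonneg (summable_pow_natAbs h0 h1) hf0 fun _ => pow_nonneg h0 _

/-- Joint absolute summability, which gives convergence of the row sums and the exchange of rows and
modes. -/
theorem summable_modeTerm_prod (hβ : 0 < β) (hd : 0 < d) (hη : 0 < η) (hηd : η ≤ d)
    (hp : |p.2| ≤ η) (i j : Fin 2) :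
    Summable fun a : ℕ × ℤ =>
      modeTerm β d a.2 (p.1 + (a.1 + 2 : ℕ) * ξ) (p.2 + (a.1 + 2 : ℕ) * η) i j := by
  have q0 := (exp_pos (-(2 * π * η / d))).le
  have q1 := exp_neg_period_lt_one hd hη
  have r0 := (exp_pos (-(β * η))).le
  have r1 : exp (-(β * η)) < 1 := by
    rw [Real.exp_lt_one_iff]
    have : 0 < β * η := by positivity
    linarith
  have hz := fun (k : ℕ) (hy : ((k + 1 : ℕ) : ℝ) * η ≤ p.2 + (k + 2 : ℕ) * η) =>
    norm_modeTerm_zero_le hβ hd hy (p.1 + (k + 2 : ℕ) * ξ) i j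
  have hnz := fun (m : ℤ) (hm : m ≠ 0) (k : ℕ) =>
    norm_modeTerm_row_le (ξ := ξ) hβ hd hη hηd hp hm k i j
  generalize exp (-(2 * π * η / d)) = q at *
  generalize exp (-(β * η)) = r at *
  have h1 := summable_prod_pow_natAbs (summable_add_mul_pow q0 q1) (fun k => by positivity) q0 q1
  have h2 := summable_prod_pow_natAbs ((summable_geometric_of_lt_one r0 r1).mul_left
    (1 / (2 * β * d))) (fun k => by positivity) q0 q1
  refine (h1.add h2).of_norm_bounded fun a => ?_
  obtain ⟨k, m⟩ := a
  by_cases hm : m = 0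
  · subst hm
    have hy : ((k + 1 : ℕ) : ℝ) * η ≤ p.2 + (k + 2 : ℕ) * η := by
      have := abs_le.mp hp
      push_cast
      linarith
    refine (hz k hy).trans ?_
    simp only [Int.natAbs_zero, pow_zero, mul_one]
    have e : r ^ (k + 1) ≤ r ^ k := pow_le_pow_of_le_one r0 r1.le (Nat.le_succ k)
    have e2 : 1 / (2 * β * d) * r ^ (k + 1) ≤ 1 / (2 * β * d) * r ^ k := by gcongr
    have e3 : 0 ≤ ((k : ℝ) + 4) * q ^ k := by positivity
    linarith
  · refine (hnz m hm k).trans ?_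
    have hm1 := Int.natAbs_pos.mpr hm
    -- `|m| (k + 1) ≥ k + |m|` for `|m| ≥ 1` decouples the two indices.
    have e : q ^ (m.natAbs * (k + 1)) ≤ q ^ (k + m.natAbs) :=
      pow_le_pow_of_le_one q0 q1.le (by nlinarith)
    have e2 : ((k : ℝ) + 4) * q ^ (m.natAbs * (k + 1)) ≤ (k + 4) * q ^ (k + m.natAbs) := by
      gcongr
    have e3 : 0 ≤ (1 / (2 * β * d) * r ^ k) * q ^ m.natAbs := by positivity
    rw [pow_add, ← mul_assoc] at e2
    simp only
    linarith

/-- A bound for the high modes, uniform in all parameters. -/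
theorem norm_expansionTerm_le (hβ : 0 < β) (hd : 0 < d) (hη : 0 < η) (hηd : η ≤ d)
    (hp : |p.2| ≤ η) {m : ℤ} (hm : m ≠ 0) {r : ℝ} (hr1 : r < 1)
    (hr : exp (-(2 * π * η / d)) ^ m.natAbs ≤ r) (i j : Fin 2) :
    ‖expansionTerm β d ξ η m p i j‖ ≤
      (∑' k : ℕ, ((k : ℝ) + 4) * r ^ k) * exp (-(2 * π * η / d)) ^ m.natAbs := by
  have hr0 : 0 ≤ r := le_trans (by positivity) hr
  have hs := ((summable_add_mul_pow hr0 hr1).mul_right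
    (exp (-(2 * π * η / d)) ^ m.natAbs)).hasSum
  rw [tsum_mul_right] at hs
  rw [← (hasSum_modeTerm hβ hd hη m p i j).tsum_eq]
  refine tsum_of_norm_bounded hs fun k => ?_
  refine (norm_modeTerm_row_le hβ hd hη hηd hp hm k i j).trans ?_
  -- One factor `q^|m|` is kept for the tail over modes; the remaining `(q^|m|)^k` is bounded by
  -- `r^k`.
  rw [mul_add, mul_one, pow_add, pow_mul, ← mul_assoc]
  gcongr

end Displacement

/-! ### Truncation error -/

theorem hasSum_ite_pow {q : ℝ} (h0 : 0 ≤ q) (h1 : q < 1) (M : ℕ) :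
    HasSum (fun n : ℕ => if n ≤ M then 0 else q ^ n) (q ^ (M + 1) / (1 - q)) := by
  rw [← hasSum_nat_add_iff' (M + 1), Finset.sum_eq_zero, sub_zero]
  · refine ((hasSum_geometric_of_lt_one h0 h1).mul_left (q ^ (M + 1))).congr_fun fun n => ?_
    rw [if_neg (by omega), pow_add, mul_comm]
  · intro n hn
    rw [if_pos (by have := Finset.mem_range.mp hn; omega)]

theorem hasSum_int_ite_pow_natAbs {q : ℝ} (h0 : 0 ≤ q) (h1 : q < 1) (M : ℕ) :
    HasSum (fun m : ℤ => if m.natAbs ≤ M then 0 else q ^ m.natAbs)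
      (q ^ (M + 1) / (1 - q) + q ^ (M + 1) / (1 - q)) := by
  have h := hasSum_ite_pow h0 h1 M
  refine HasSum.of_nat_of_neg_add_one (by simpa using h) ?_
  have h2 := (hasSum_nat_add_iff' 1).mpr h
  simp only [Finset.range_one, Finset.sum_singleton, Nat.zero_le, if_true, sub_zero] at h2
  refine h2.congr_fun fun n => ?_
  have : (-((n : ℤ) + 1)).natAbs = n + 1 := by omega
  rw [this]

/-- The truncation order bounds the geometric tail. -/
theorem exp_pow_truncationOrder_le {d η ε : ℝ} (hd : 0 < d) (hη : 0 < η) (hε : 0 < ε) :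
    exp (-(2 * π * η / d)) ^ truncationOrder d η ε ≤
      ε * (1 - exp (-(2 * π * η / d))) := by
  have q1 := exp_neg_period_lt_one hd hη
  have h := Nat.le_ceil (d / (2 * π * η) *
    Real.log (1 / (1 - Real.exp (-(2 * π * η / d))) * (1 / ε)))
  rw [← truncationOrder] at h
  have hpos : 0 < ε * (1 - exp (-(2 * π * η / d))) := mul_pos hε (by linarith)
  have hL : 1 / (1 - exp (-(2 * π * η / d))) * (1 / ε) =
      (ε * (1 - exp (-(2 * π * η / d))))⁻¹ := by
    rw [mul_inv, one_div, one_div, mul_comm]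
  rw [hL, Real.log_inv] at h
  rw [← Real.exp_nat_mul]
  refine le_of_le_of_eq (Real.exp_le_exp.mpr ?_) (Real.exp_log hpos)
  have hδ : 0 < 2 * π * η / d := by positivity
  have := mul_le_mul_of_nonneg_right h hδ.le
  have e : d / (2 * π * η) * -Real.log (ε * (1 - exp (-(2 * π * η / d)))) * (2 * π * η / d) =
      -Real.log (ε * (1 - exp (-(2 * π * η / d)))) := by field_simp
  rw [e] at this
  linarith

/-- The constant in the error bound. -/
noncomputable def errorConstant : ℝ :=
  2 * ∑' k : ℕ, ((k : ℝ) + 4) * (1 - exp (-(2 * π))) ^ k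

/-- The modes beyond `M` contribute at most `2 S q^(M+1) / (1 - q)`, and the truncation order makes
`q^M / (1 - q) ≤ ε`. That `S` is absolute needs `q^|m|` away from `1` even when `q` is near `1`: for
`|m| > M` it is at most `ε (1 - q)`. -/
theorem truncation_error_le {β d ξ η ε : ℝ} {p : ℝ × ℝ} (hβ : 0 < β) (hd : 0 < d) (hη : 0 < η)
    (hηd : η ≤ d) (hp : |p.2| ≤ η) (hε : 0 < ε) (hε1 : ε ≤ 1) (i j : Fin 2) {M : ℕ}
    (hM : M = truncationOrder d η ε) :
    ‖∑' m : ℤ, expansionTerm β d ξ η m p i j -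
      ∑ m ∈ Finset.Icc (-(M : ℤ)) M, expansionTerm β d ξ η m p i j‖ ≤ errorConstant * ε := by
  have q0 := exp_pos (-(2 * π * η / d))
  have q1 := exp_neg_period_lt_one hd hη
  have hqM := exp_pow_truncationOrder_le hd hη hε
  rw [← hM] at hqM
  -- The shape condition `η ≤ d` bounds `q` below by `exp (-2π)`, which makes the ratio in
  -- `errorConstant` absolute.
  have hr : 1 - exp (-(2 * π * η / d)) ≤ 1 - exp (-(2 * π)) := by
    have : exp (-(2 * π)) ≤ exp (-(2 * π * η / d)) := by
      apply Real.exp_le_exp.mpr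
      rw [neg_le_neg_iff, div_le_iff₀ hd]
      have := Real.pi_pos
      gcongr
    linarith
  have hs : Summable fun m : ℤ => expansionTerm β d ξ η m p i j := by
    have h := (summable_modeTerm_prod (ξ := ξ) hβ hd hη hηd hp i j).prod_symm.prod
    refine h.congr fun m => ?_
    exact (hasSum_modeTerm hβ hd hη m p i j).tsum_eq
  set q := exp (-(2 * π * η / d)) with hq
  have hr1 : 1 - exp (-(2 * π)) < 1 := by
    have := exp_pos (-(2 * π))
    linarith
  have hr0 : 0 ≤ 1 - exp (-(2 * π)) := by linarith
  set S := ∑' k : ℕ, ((k : ℝ) + 4) * (1 - exp (-(2 * π))) ^ k with hS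
  have hS0 : 0 ≤ S := tsum_nonneg fun k => by positivity
  have hmem : ∀ m : ℤ, m ∈ Finset.Icc (-(M : ℤ)) M ↔ m.natAbs ≤ M := fun m => by
    rw [Finset.mem_Icc]
    omega
  have hfin : HasSum (fun m : ℤ => if m.natAbs ≤ M then expansionTerm β d ξ η m p i j else 0)
      (∑ m ∈ Finset.Icc (-(M : ℤ)) M, expansionTerm β d ξ η m p i j) := by
    have h : HasSum (fun m : ℤ => if m.natAbs ≤ M then expansionTerm β d ξ η m p i j else 0)
        (∑ m ∈ Finset.Icc (-(M : ℤ)) M,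
          if m.natAbs ≤ M then expansionTerm β d ξ η m p i j else 0) :=
      hasSum_sum_of_ne_finset_zero fun m hm => if_neg fun h => hm ((hmem m).mpr h)
    rwa [Finset.sum_congr rfl fun m hm => if_pos ((hmem m).mp hm)] at h
  have htail := hs.hasSum.sub hfin
  rw [← htail.tsum_eq]
  have hb := (hasSum_int_ite_pow_natAbs q0.le q1 M).mul_left S
  refine (tsum_of_norm_bounded hb fun m => ?_).trans ?_
  · by_cases hm : m.natAbs ≤ M
    · simp [hm]
    · simp only [if_neg hm, sub_zero]
      refine norm_expansionTerm_le hβ hd hη hηd hp (by rintro rfl; simp at hm) hr1 ?_ i j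
      calc q ^ m.natAbs ≤ q ^ M := pow_le_pow_of_le_one q0.le q1.le (by omega)
        _ ≤ ε * (1 - q) := hqM
        _ ≤ 1 - exp (-(2 * π)) := by nlinarith
  · have h1 : q ^ (M + 1) / (1 - q) ≤ ε := by
      rw [div_le_iff₀ (by linarith)]
      exact (pow_le_pow_of_le_one q0.le q1.le (Nat.le_succ M)).trans hqM
    rw [errorConstant, ← hS]
    nlinarith


/-! ### The south kernel -/

theorem summable_matrix_iff {ι : Type*} {f : ι → Matrix (Fin 2) (Fin 2) ℝ} :
    Summable f ↔ ∀ a b, Summable fun i => f i a b :=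
  Pi.summable.trans (forall_congr' fun _ => Pi.summable)

theorem tsum_matrix_apply {ι : Type*} {f : ι → Matrix (Fin 2) (Fin 2) ℝ} (hf : Summable f)
    (a b : Fin 2) : (∑' i, f i) a b = ∑' i, f i a b :=
  ((Pi.hasSum.mp (Pi.hasSum.mp hf.hasSum a) b).tsum_eq).symm

/-- The rows `n ≤ -2`, enumerated from the nearest one. -/
def southRows : ℕ ≃ Set.Iic (-2 : ℤ) where
  toFun k := ⟨-((k + 2 : ℕ) : ℤ), by simp⟩
  invFun n := (-n.1 - 2).toNat
  left_inv k := by simp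
  right_inv n := by
    have := n.2
    simp only [Set.mem_Iic] at this
    ext
    simp only
    omega

theorem le_neg_two_iff {n : ℤ} : n ≤ -2 ↔ ∃ k : ℕ, n = -((k + 2 : ℕ) : ℤ) :=
  ⟨fun h => ⟨(-n - 2).toNat, by omega⟩, fun ⟨k, hk⟩ => by omega⟩

section South

variable {β d ξ η : ℝ} {t s : ℝ × ℝ}

theorem row_sum_south (hβ : 0 < β) (hd : 0 < d) (hη : 0 < η) (hp : |t.2 - s.2| ≤ η) (k : ℕ)
    (i j : Fin 2) :
    (Summable fun m : ℤ => imageTerm β d ξ η t s m (-((k + 2 : ℕ) : ℤ)) i j) ∧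
      ((∑' m : ℤ, imageTerm β d ξ η t s m (-((k + 2 : ℕ) : ℤ)) i j : ℝ) : ℂ) =
        ∑' m : ℤ, modeTerm β d m ((t - s).1 + (k + 2 : ℕ) * ξ) ((t - s).2 + (k + 2 : ℕ) * η)
          i j := by
  have := abs_le.mp hp
  have hk : (0 : ℝ) ≤ k * η := by positivity
  have h := row_sum_imageTerm (ξ := ξ) (n := -((k + 2 : ℕ) : ℤ)) hβ hd
    (by push_cast; nlinarith : 0 < t.2 - s.2 - ((-((k + 2 : ℕ) : ℤ) : ℤ) : ℝ) * η) i j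
  refine ⟨h.1, h.2.trans ?_⟩
  have e1 : t.1 - s.1 - ((-((k + 2 : ℕ) : ℤ) : ℤ) : ℝ) * ξ =
      (t - s).1 + (k + 2 : ℕ) * ξ := by push_cast [Prod.fst_sub]; ring
  have e2 : t.2 - s.2 - ((-((k + 2 : ℕ) : ℤ) : ℤ) : ℝ) * η =
      (t - s).2 + (k + 2 : ℕ) * η := by push_cast [Prod.snd_sub]; ring
  rw [e1, e2]

theorem rowsConverge_south (hβ : 0 < β) (hd : 0 < d) (hη : 0 < η) (hηd : η ≤ d)
    (hp : |t.2 - s.2| ≤ η) : RowsConverge (Set.Iic (-2)) β d ξ η t s := by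
  have hrow : ∀ n ∈ Set.Iic (-2 : ℤ), Summable fun m : ℤ => imageTerm β d ξ η t s m n := by
    intro n hn
    obtain ⟨k, rfl⟩ := le_neg_two_iff.mp hn
    exact summable_matrix_iff.mpr fun a b => (row_sum_south hβ hd hη hp k a b).1
  refine ⟨hrow, summable_matrix_iff.mpr fun a b => southRows.summable_iff.mp ?_⟩
  rw [← Complex.summable_ofReal]
  refine (summable_modeTerm_prod (ξ := ξ) (p := t - s) hβ hd hη hηd hp a b).prod.congr fun k => ?_
  rw [Function.comp_apply, tsum_matrix_apply (hrow _ (southRows k).2)]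
  exact (row_sum_south hβ hd hη hp k a b).2.symm

/-- Poisson summation in each row, exchange of the sums over rows and modes, then the geometric
series for each mode. -/
theorem kernelSouth_eq (hβ : 0 < β) (hd : 0 < d) (hη : 0 < η) (hηd : η ≤ d)
    (hp : |t.2 - s.2| ≤ η) (a b : Fin 2) :
    ((kernelSouth β d ξ η t s a b : ℝ) : ℂ) =
      ∑' m : ℤ, expansionTerm β d ξ η m (t - s) a b := by
  have hc := rowsConverge_south (ξ := ξ) hβ hd hη hηd hp
  rw [kernelSouth, tsum_matrix_apply hc.2, ← southRows.tsum_eq, Complex.ofReal_tsum]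
  have e : ∀ k : ℕ, (((∑' m : ℤ, imageTerm β d ξ η t s m (southRows k : ℤ)) a b : ℝ) : ℂ) =
      ∑' m : ℤ, modeTerm β d m ((t - s).1 + (k + 2 : ℕ) * ξ) ((t - s).2 + (k + 2 : ℕ) * η)
          a b := fun k => by
    rw [tsum_matrix_apply (hc.1 _ (southRows k).2)]
    exact (row_sum_south hβ hd hη hp k a b).2
  simp only [e]
  have hS := summable_modeTerm_prod (ξ := ξ) (p := t - s) hβ hd hη hηd hp a b
  refine Eq.trans (Summable.tsum_comm ?_) ?_
  · exact hS.prod_symm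
  · exact tsum_congr fun m => (hasSum_modeTerm hβ hd hη m (t - s) a b).tsum_eq

end South

/-! ### The north kernel by reflection -/

section North

variable {β d ξ η : ℝ} {t s : ℝ × ℝ}

/-- The Stokeslet is even, and `t - (s + l) = -(s - (t - l))`. -/
theorem imageTerm_swap (hβ : 0 < β) (hη : 0 < η) (hp : |t.2 - s.2| ≤ η) (m : ℤ) {n : ℤ}
    (hn : 2 ≤ n) : imageTerm β d ξ η t s m n = imageTerm β d ξ η s t (-m) (-n) := by
  have hn' : (2 : ℝ) ≤ n := by exact_mod_cast hn
  have := abs_le.mp hp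
  have h2 : 2 * η ≤ n * η := by gcongr
  rw [imageTerm, imageTerm, ← modifiedStokeslet_neg hβ]
  · congr 1
    ext <;> simp [latticeVector] <;> ring
  · simp only [latticeVector, Prod.snd_sub, Prod.snd_add, Prod.smul_snd, smul_eq_mul]
    have : t.2 - (s.2 + (m * 0 + n * η)) < 0 := by linarith
    exact this.ne

/-- Negation as a bijection from the north rows to the south rows. -/
def northRows : Set.Ici (2 : ℤ) ≃ Set.Iic (-2 : ℤ) where
  toFun n := ⟨-n.1, by have := n.2; simp only [Set.mem_Ici, Set.mem_Iic] at *; omega⟩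
  invFun n := ⟨-n.1, by have := n.2; simp only [Set.mem_Ici, Set.mem_Iic] at *; omega⟩
  left_inv n := by simp
  right_inv n := by simp

theorem row_swap (hβ : 0 < β) (hη : 0 < η) (hp : |t.2 - s.2| ≤ η) {n : ℤ} (hn : 2 ≤ n) :
    (fun m => imageTerm β d ξ η t s m n) =
      (fun m => imageTerm β d ξ η s t m (-n)) ∘ Equiv.neg ℤ :=
  funext fun m => imageTerm_swap hβ hη hp m hn

theorem row_tsum_swap (hβ : 0 < β) (hη : 0 < η) (hp : |t.2 - s.2| ≤ η) :
    (fun n : Set.Ici (2 : ℤ) => ∑' m : ℤ, imageTerm β d ξ η t s m n) =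
      (fun n : Set.Iic (-2 : ℤ) => ∑' m : ℤ, imageTerm β d ξ η s t m n) ∘ northRows := by
  ext1 n
  rw [row_swap hβ hη hp n.2]
  exact (Equiv.neg ℤ).tsum_eq (fun m => imageTerm β d ξ η s t m (-n.1))

theorem rowsConverge_north (hβ : 0 < β) (hd : 0 < d) (hη : 0 < η) (hηd : η ≤ d)
    (hp : |t.2 - s.2| ≤ η) : RowsConverge (Set.Ici 2) β d ξ η t s := by
  have hc := rowsConverge_south (ξ := ξ) (t := s) (s := t) hβ hd hη hηd (abs_sub_comm t.2 s.2 ▸ hp)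
  refine ⟨fun n hn => ?_, ?_⟩
  · rw [row_swap hβ hη hp hn]
    exact (Equiv.neg ℤ).summable_iff.mpr (hc.1 _ (northRows ⟨n, hn⟩).2)
  · rw [row_tsum_swap hβ hη hp]
    exact northRows.summable_iff.mpr hc.2

theorem kernelNorth_eq (hβ : 0 < β) (hη : 0 < η) (hp : |t.2 - s.2| ≤ η) :
    kernelNorth β d ξ η t s = kernelSouth β d ξ η s t := by
  rw [kernelNorth, row_tsum_swap hβ hη hp]
  exact northRows.tsum_eq (fun n : Set.Iic (-2 : ℤ) => ∑' m : ℤ, imageTerm β d ξ η s t m n)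

end North

/-! ### Entries of the factored matrices and conclusion -/

theorem factor_product_apply (σ σ' : ℝ) (hσ : σ' = -σ) (ω : ℤ → ℝ) (d : ℝ) (M : ℕ) {NT NS : ℕ}
    (T : Fin NT → ℝ × ℝ) (S : Fin NS → ℝ × ℝ) (D : ℤ → Matrix (Fin 2) (Fin 2) ℂ) (l : Fin NT)
    (j : Fin NS) (a b : Fin 2) :
    (leftFactor σ ω d M T * Matrix.diagonal (fun m : Mode M => D m) * rightFactor σ' ω d M S)
      l j a b = ∑ m ∈ Finset.Icc (-(M : ℤ)) M,
        Complex.exp (Complex.I * alpha d m * (T l - S j).1) *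
          ((exp (σ * ω m * (T l - S j).2) : ℝ) : ℂ) * D m a b := by
  rw [← Finset.sum_coe_sort, Matrix.mul_apply, Matrix.sum_apply]
  refine Finset.sum_congr rfl fun m _ => ?_
  rw [Matrix.mul_diagonal]
  simp only [leftFactor, rightFactor, Matrix.of_apply, smul_mul_assoc, one_mul, mul_smul_comm,
    mul_one, Matrix.smul_apply, smul_eq_mul, hσ]
  have h : Complex.exp (Complex.I * alpha d m * (T l - S j).1) *
      ((exp (σ * ω m * (T l - S j).2) : ℝ) : ℂ) =
      (Complex.exp ((-σ * ω m * (S j).2 : ℝ)) * Complex.exp (-(Complex.I * alpha d m * (S j).1))) *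
      (Complex.exp ((σ * ω m * (T l).2 : ℝ)) * Complex.exp (Complex.I * alpha d m * (T l).1)) := by
    rw [Complex.ofReal_exp, ← Complex.exp_add, ← Complex.exp_add, ← Complex.exp_add,
      ← Complex.exp_add]
    push_cast [Prod.fst_sub, Prod.snd_sub]
    ring_nf
  rw [h]
  ring

theorem expansionSouth_apply (β d ξ η : ℝ) (M : ℕ) {NT NS : ℕ} (T : Fin NT → ℝ × ℝ)
    (S : Fin NS → ℝ × ℝ) (l : Fin NT) (j : Fin NS) (a b : Fin 2) :
    (LBetaSouth β d M T * DBetaSouth β d ξ η M * RBetaSouth β d M S +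
      LSouth d M T * DSouth β d ξ η M * RSouth d M S) l j a b =
      ∑ m ∈ Finset.Icc (-(M : ℤ)) M, expansionTerm β d ξ η m (T l - S j) a b := by
  rw [Matrix.add_apply, Matrix.add_apply, LBetaSouth, DBetaSouth, RBetaSouth, LSouth, DSouth,
    RSouth, factor_product_apply (-1) 1 (by norm_num), factor_product_apply (-1) 1 (by norm_num),
    ← Finset.sum_add_distrib]
  refine Finset.sum_congr rfl fun m _ => ?_
  simp only [expansionTerm, one_mul, neg_mul]
  ring

/-- Exchanging target and source reverses the phase, which conjugation restores; the real
exponentials acquire the north signs and the blocks become conjugates. -/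
theorem expansionNorth_apply (β d ξ η : ℝ) (M : ℕ) {NT NS : ℕ} (T : Fin NT → ℝ × ℝ)
    (S : Fin NS → ℝ × ℝ) (l : Fin NT) (j : Fin NS) (a b : Fin 2) :
    (LBetaNorth β d M T * DBetaNorth β d ξ η M * RBetaNorth β d M S +
      LNorth d M T * DNorth β d ξ η M * RNorth d M S) l j a b =
      starRingEnd ℂ
        (∑ m ∈ Finset.Icc (-(M : ℤ)) M, expansionTerm β d ξ η m (S j - T l) a b) := by
  rw [Matrix.add_apply, Matrix.add_apply, LBetaNorth, DBetaNorth, RBetaNorth, LNorth, DNorth,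
    RNorth,
    factor_product_apply 1 (-1) (by norm_num) _ _ _ _ _
      (fun m => (blockBetaSouth β d ξ η m).map (starRingEnd ℂ)),
    factor_product_apply 1 (-1) (by norm_num) _ _ _ _ _
      (fun m => (blockSouth β d ξ η m).map (starRingEnd ℂ)),
    ← Finset.sum_add_distrib, map_sum]
  refine Finset.sum_congr rfl fun m _ => ?_
  simp only [expansionTerm, map_mul, map_add, Complex.conj_ofReal, ← Complex.exp_conj,
    Complex.conj_I, Matrix.map_apply]
  have e1 : Complex.I * alpha d m * ((T l - S j).1 : ℂ) =
      -Complex.I * alpha d m * ((S j - T l).1 : ℂ) := by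
    push_cast [Prod.fst_sub]
    ring
  have e2 : ∀ ω : ℝ, 1 * ω * (T l - S j).2 = -(ω * (S j - T l).2) := fun ω => by
    simp only [Prod.snd_sub]
    ring
  rw [e1, e2, e2]
  ring

theorem abs_snd_sub_le_of_mem_unitCell {d ξ η : ℝ} (hη : 0 < η) {t s : ℝ × ℝ}
    (ht : t ∈ unitCell d ξ η) (hs : s ∈ unitCell d ξ η) : |t.2 - s.2| ≤ η := by
  obtain ⟨a, -, b, hb, rfl⟩ := ht
  obtain ⟨a', -, b', hb', rfl⟩ := hs
  simp only [Prod.snd_add, Prod.smul_snd, smul_eq_mul, mul_zero, zero_add]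
  rw [← sub_mul, abs_mul, abs_of_pos hη]
  have : |b - b'| ≤ 1 := by
    rw [abs_le]
    constructor <;> linarith [hb.1, hb.2, hb'.1, hb'.2]
  nlinarith

theorem errorConstant_pos : 0 < errorConstant := by
  have h1 : exp (-(2 * π)) < 1 := by
    rw [Real.exp_lt_one_iff]
    linarith [pi_pos]
  have h0 : 0 ≤ 1 - exp (-(2 * π)) := by linarith
  have hs := summable_add_mul_pow h0 (by linarith [exp_pos (-(2 * π))])
  exact mul_pos two_pos (hs.tsum_pos (fun k => by positivity) 0 (by norm_num))

end ModifiedStokes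

theorem mainTheorem6 :
    ∃ C : ℝ, 0 < C ∧
      ∀ β d ξ η ε : ℝ, 0 < β → 0 < d → 0 < η → Real.sqrt (ξ ^ 2 + η ^ 2) ≤ d →
        0 < ε → ε ≤ 1 →
        ∀ (NT NS : ℕ) (T : Fin NT → ℝ × ℝ) (S : Fin NS → ℝ × ℝ),
          (∀ l, T l ∈ unitCell d ξ η) → (∀ j, S j ∈ unitCell d ξ η) →
          ∀ M : ℕ, M = truncationOrder d η ε →
          (∀ l j, RowsConverge (Set.Iic (-2)) β d ξ η (T l) (S j) ∧
            RowsConverge (Set.Ici 2) β d ξ η (T l) (S j)) ∧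
          (∀ l j a b,
            ‖(periodizingSouth β d ξ η T S -
              (LBetaSouth β d M T * DBetaSouth β d ξ η M * RBetaSouth β d M S +
                LSouth d M T * DSouth β d ξ η M * RSouth d M S)) l j a b‖ ≤ C * ε) ∧
          (∀ l j a b,
            ‖(periodizingNorth β d ξ η T S -
              (LBetaNorth β d M T * DBetaNorth β d ξ η M * RBetaNorth β d M S +
                LNorth d M T * DNorth β d ξ η M * RNorth d M S)) l j a b‖ ≤ C * ε) := by
  refine ⟨errorConstant, errorConstant_pos, ?_⟩
  intro β d ξ η ε hβ hd hη hξη hε hε1 NT NS T S hT hS M hM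
  have hηd : η ≤ d := le_trans (Real.le_sqrt_of_sq_le (by nlinarith [sq_nonneg ξ])) hξη
  have hp := fun l j => abs_snd_sub_le_of_mem_unitCell hη (hT l) (hS j)
  have hp' := fun l j => abs_snd_sub_le_of_mem_unitCell hη (hS j) (hT l)
  refine ⟨fun l j => ⟨rowsConverge_south hβ hd hη hηd (hp l j),
    rowsConverge_north hβ hd hη hηd (hp l j)⟩, fun l j a b => ?_, fun l j a b => ?_⟩
  · rw [Matrix.sub_apply, Matrix.sub_apply, expansionSouth_apply, periodizingSouth,
      Matrix.of_apply, Matrix.map_apply, kernelSouth_eq hβ hd hη hηd (hp l j)]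
    exact truncation_error_le (p := T l - S j) hβ hd hη hηd (hp l j) hε hε1 a b hM
  -- The kernel is real, hence its own conjugate, so this error is the conjugate of the south error
  -- with target and source exchanged.
  · rw [Matrix.sub_apply, Matrix.sub_apply, expansionNorth_apply, periodizingNorth,
      Matrix.of_apply, Matrix.map_apply, kernelNorth_eq hβ hη (hp l j),
      ← Complex.conj_ofReal, ← map_sub, RCLike.norm_conj,
      kernelSouth_eq hβ hd hη hηd (hp' l j)]
    exact truncation_error_le (p := S j - T l) hβ hd hη hηd (hp' l j) hε hε1 a b hM
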